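/- **Setting.** Let $p\ge 1$, $\theta_\star\in\mathbb R^p$, and let $x_1,x_2,\dots\in\mathbb R^p$ be non-random. Under $\mathbb P_{\theta_\star}$ the responses $Y_1,Y_2,\dots$ are independent, $\{0,1\}$-valued, with $\mathbb P_{\theta_\star}(Y_t=1)=b'(x_t^\top\theta_\star)$, where $b(u)=\log(1+e^u)$. Put $\ell_t(\theta)=b(x_t^\top\theta)-Y_t\,x_t^\top\theta$ for $\theta\in\mathbb R^p$, $\mathbf F_{t,\theta}=\sum_{s=1}^t\nabla^2\ell_s(\theta)$, and, for $r>0$, $\Theta_r=\{\theta\in\mathbb R^p:\|\theta-\theta_\star\|_2\le r\}$. Write $\lambda_{\min},\lambda_{\max}$ for the smallest and largest singular values, $\|\cdot\|_2$ for the Euclidean norm and the spectral norm, and $\preceq$ for the Loewner order. Let $\theta_0\in\mathbb R^p$ and a symmetric positive definite $\mathbf\Omega_0\in\mathbb R^{p\times p}$ be non-random, let $$\hat\theta_t^{\rm MAP}=\operatorname*{arg\,min}_{\theta\in\mathbb R^p}\Big\{\sum_{s=1}^t\ell_s(\theta)+\tfrac12\|\mathbf\Omega_0^{1/2}(\theta-\theta_0)\|_2^2\Big\},$$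 and let $t_0\in\mathbb N=\{1,2,\dots\}$. For $1\le t\le t_0$ set $\theta_t=\hat\theta_t^{\rm MAP}$ and $\mathbf\Omega_t=\mathbf\Omega_0+\sum_{s=1}^t\nabla^2\ell_s(\hat\theta_t^{\rm MAP})$. For $t>t_0$ set $g_t=\nabla\ell_t(\theta_{t-1})$, $\mathbf\Omega_t=\mathbf\Omega_{t-1}+\nabla^2\ell_t(\theta_{t-1})$ and $\theta_t=\theta_{t-1}-\mathbf\Omega_t^{-1}g_t$. Let $t_{\rm exit}=\inf\{t\in\mathbb N:t>t_0,\ \theta_t\notin\Theta_r\}$, with $\inf\emptyset=\infty$. **Condition (Ex)**, for given $\mathrm x,r>0$ and constants $K_{\min},K_{\max}>0$: $(1\vee r)\|x_t\|_2\le K_{\max}$ for all $t\in\mathbb N$; for all $t\in\mathbb N$ with $t\ge K_{\max}p$, $$\lambda_{\min}\Big(\sum_{s\le t,\ |x_s^\top\theta_\star|\le K_{\max}}x_sx_s^\top\Big)\ge K_{\min}t,\qquad \lambda_{\max}\Big(\sum_{s\le t}x_sx_s^\top\Big)\le K_{\max}t;$$ and $\mathbb P_{\theta_\star}(\hat\theta_{t'}^{\rm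 MAP}\in\Theta_r)\ge 1-e^{-\mathrm x}$ for all $t'\in\mathbb N$ with $t'\ge K_{\max}(p+\mathrm x)$. **Corollary.** For all $K_{\min},K_{\max}>0$ there is a constant $K=K(K_{\min},K_{\max})>0$ such that, whenever $\mathrm x,r>0$, (Ex) holds with $K_{\min},K_{\max}$, and $t_0\ge K_{\max}(p+\mathrm x)$, there is an event $\mathscr E(\mathrm x)$ with $\mathbb P_{\theta_\star}(\mathscr E(\mathrm x))\ge 1-3e^{-\mathrm x}$ on which the following hold. For every $t\in\mathbb N$ with $t>t_0$, $$\inf_{\{\bar\theta_s\}_{s=1}^t\subset\Theta_r}\lambda_{\min}\Big(\sum_{s=1}^t\nabla^2\ell_s(\bar\theta_s)\Big)\ge K^{-1}t,\qquad \sum_{s=t_0+1}^t\{\ell_s(\theta_\star)-\ell_s(\theta_{s-1})\}\le K\mathrm x,$$ $$\sum_{s=t_0+1}^{t\wedge t_{\rm exit}}\langle g_s,\mathbf\Omega_s^{-1}g_s\rangle\le K\big(p\log(t\wedge t_{\rm exit})+\mathrm x\big).$$ For every $t\in\mathbb N$ and all $\theta,\theta',\theta+h,\theta_1,\theta_2\in\Theta_r$,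 $$\|\nabla^2\ell_t(\theta)\|_2\le K,\qquad \|\nabla^2\ell_t(\theta)-\nabla^2\ell_t(\theta')\|_2\le K\|\theta-\theta'\|_2,$$ $$e^{-K\|h\|_2}\mathbf F_{t,\theta}\preceq\mathbf F_{t,\theta+h}\preceq e^{K\|h\|_2}\mathbf F_{t,\theta},\qquad \nabla^2\ell_t(\theta_1)\preceq(1+K\|\theta_1-\theta_2\|_2)\nabla^2\ell_t(\tilde\theta)$$ for some $\tilde\theta\in\Theta_r$ on the line segment between $\theta_1$ and $\theta_2$ satisfying $$\ell_t(\theta_1)=\ell_t(\theta_2)+\langle\nabla\ell_t(\theta_2),\theta_1-\theta_2\rangle+\tfrac12\langle\nabla^2\ell_t(\tilde\theta),(\theta_1-\theta_2)^{\otimes2}\rangle.$$ -/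

import Mathlib

open MeasureTheory ProbabilityTheory

noncomputable section

namespace OnlineLogit

/-- The parameter space `Θ = ℝ^p` with its Euclidean norm. -/
abbrev Param (p : ℕ) := EuclideanSpace ℝ (Fin p)

/-- Real `p × p` matrices. -/
abbrev Mat (p : ℕ) := Matrix (Fin p) (Fin p) ℝ

/-- The operator of multiplication by `A`, on Euclidean space. -/
abbrev toOp {p : ℕ} (A : Mat p) : Param p →L[ℝ] Param p :=
  Matrix.toEuclideanCLM (n := Fin p) (𝕜 := ℝ) A

/-- `‖A‖₂`: the operator norm with respect to the Euclidean norm. -/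
def opNorm {p : ℕ} (A : Mat p) : ℝ := ‖toOp A‖

/-- `⟨A, v ⊗ v⟩ = ⟨v, A v⟩`. -/
def quadForm {p : ℕ} (A : Mat p) (v : Param p) : ℝ := inner ℝ v (toOp A v)

/-- `λ_min(A)`: the smallest singular value of a square matrix (Mathlib's singular values are listed
in decreasing order, with multiplicity, from index `0`). -/
def lamMin {p : ℕ} (A : Mat p) : ℝ :=
  (toOp A : Param p →ₗ[ℝ] Param p).singularValues (p - 1)

/-- `λ_max(A)`: the largest singular value. -/
def lamMax {p : ℕ} (A : Mat p) : ℝ :=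
  (toOp A : Param p →ₗ[ℝ] Param p).singularValues 0

/-- The Loewner order: `A ⪯ B` when `B - A` is symmetric positive semi-definite. -/
def LoewnerLE {p : ℕ} (A B : Mat p) : Prop := (B - A).PosSemidef

/-- `x xᵀ`. -/
def outer {p : ℕ} (x : Param p) : Mat p := Matrix.of fun i j => x i * x j

/-- The Hessian matrix of second partial derivatives. -/
def hess {p : ℕ} (f : Param p → ℝ) (θ : Param p) : Mat p :=
  Matrix.of fun i j =>
    fderiv ℝ (fun η => fderiv ℝ f η (EuclideanSpace.single j 1)) θ (EuclideanSpace.single i 1)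

/-- `b(u) = log (1 + exp u)`. -/
def softplus (u : ℝ) : ℝ := Real.log (1 + Real.exp u)

/-- Negative log-likelihood of one response `y` with covariate `x`. -/
def loss {p : ℕ} (x : Param p) (y : ℝ) (θ : Param p) : ℝ :=
  softplus (inner ℝ x θ) - y * inner ℝ x θ

/-- `Θ_r`, the closed ball of radius `r` around the true parameter. -/
def localSet {p : ℕ} (θstar : Param p) (r : ℝ) : Set (Param p) := {θ | ‖θ - θstar‖ ≤ r}

/-- `F_{t,θ}`: the sum of the Hessians of `ℓ_1, …, ℓ_t` at `θ`. -/
def fisher {p : ℕ} (x : ℕ → Param p) (y : ℕ → ℝ) (t : ℕ) (θ : Param p) : Mat p :=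
  ∑ s ∈ Finset.Icc 1 t, hess (loss (x s) (y s)) θ

/-- `I_t(τ)`: the indices `s ∈ {1, …, t}` with `|⟨x_s, θ_⋆⟩| ≤ τ`. -/
def goodIdx {p : ℕ} (x : ℕ → Param p) (θstar : Param p) (τ : ℝ) (t : ℕ) : Finset ℕ :=
  {s ∈ Finset.Icc 1 t | |inner ℝ (x s) θstar| ≤ τ}

/-- The penalised objective `∑_{s ≤ t} ℓ_s(θ) + ½ ‖Ω₀^{1/2} (θ - θ₀)‖²`. -/
def mapObjective {p : ℕ} (x : ℕ → Param p) (y : ℕ → ℝ) (θ₀ : Param p) (Om₀ : Mat p)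
    (t : ℕ) (θ : Param p) : ℝ :=
  (∑ s ∈ Finset.Icc 1 t, loss (x s) (y s) θ) + (1 / 2) * quadForm Om₀ (θ - θ₀)

/-- The batch MAP estimator: the minimiser of the penalised objective over `ℝ^p`
(it exists and is unique when `Ω₀` is positive definite). -/
def mapEst {p : ℕ} (x : ℕ → Param p) (y : ℕ → ℝ) (θ₀ : Param p) (Om₀ : Mat p)
    (t : ℕ) : Param p :=
  Classical.epsilon fun θ => IsMinOn (mapObjective x y θ₀ Om₀ t) Set.univ θ

/-- One online update with the loss `f`, from `(θ_{t-1}, Ω_{t-1})` to `(θ_t, Ω_t)`: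
`Ω_t = Ω_{t-1} + ∇²f(θ_{t-1})` and `θ_t = θ_{t-1} - Ω_t⁻¹ ∇f(θ_{t-1})`. -/
def onlineStep {p : ℕ} (f : Param p → ℝ) (prev : Param p × Mat p) : Param p × Mat p :=
  (prev.1 - toOp (prev.2 + hess f prev.1)⁻¹ (gradient f prev.1), prev.2 + hess f prev.1)

/-- The one-pass algorithm: the pair `(θ_t, Ω_t)` computed from the design `x`, the responses `y`,
the prior parameters and the phase transition time `t₀`; batch MAP updates up to time `t₀`,
online updates afterwards. -/
def state {p : ℕ} (x : ℕ → Param p) (y : ℕ → ℝ) (θ₀ : Param p) (Om₀ : Mat p) (t₀ : ℕ) :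
    ℕ → Param p × Mat p
  | 0 => (θ₀, Om₀)
  | t + 1 =>
    if t + 1 ≤ t₀ then
      (mapEst x y θ₀ Om₀ (t + 1), Om₀ + fisher x y (t + 1) (mapEst x y θ₀ Om₀ (t + 1)))
    else
      onlineStep (loss (x (t + 1)) (y (t + 1))) (state x y θ₀ Om₀ t₀ t)

/-- `θ_t`. -/
def iter {p : ℕ} (x : ℕ → Param p) (y : ℕ → ℝ) (θ₀ : Param p) (Om₀ : Mat p) (t₀ t : ℕ) :
    Param p :=
  (state x y θ₀ Om₀ t₀ t).1

/-- `Ω_t`. -/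
def prec {p : ℕ} (x : ℕ → Param p) (y : ℕ → ℝ) (θ₀ : Param p) (Om₀ : Mat p) (t₀ t : ℕ) :
    Mat p :=
  (state x y θ₀ Om₀ t₀ t).2

/-- `g_t = ∇ℓ_t(θ_{t-1})`, for `t ≥ 1`. -/
def grad {p : ℕ} (x : ℕ → Param p) (y : ℕ → ℝ) (θ₀ : Param p) (Om₀ : Mat p) (t₀ t : ℕ) :
    Param p :=
  gradient (loss (x t) (y t)) (iter x y θ₀ Om₀ t₀ (t - 1))

/-- `t_exit`: the first time after `t₀` at which `θ_t` is outside `Θ_r`, and `∞` if there is none. -/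
def exitTime {p : ℕ} (x : ℕ → Param p) (y : ℕ → ℝ) (θ₀ : Param p) (Om₀ : Mat p) (t₀ : ℕ)
    (θstar : Param p) (r : ℝ) : ℕ∞ :=
  sInf {n : ℕ∞ | ∃ t : ℕ, n = t ∧ t₀ < t ∧ iter x y θ₀ Om₀ t₀ t ∉ localSet θstar r}

/-- `t ∧ t_exit`, a natural number. -/
def stopAt {p : ℕ} (x : ℕ → Param p) (y : ℕ → ℝ) (θ₀ : Param p) (Om₀ : Mat p) (t₀ : ℕ)
    (θstar : Param p) (r : ℝ) (t : ℕ) : ℕ :=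
  (min (t : ℕ∞) (exitTime x y θ₀ Om₀ t₀ θstar r)).toNat

/-- The observed sequence of responses at the outcome `ω`. -/
def path {S : Type*} (Y : ℕ → S → ℝ) (ω : S) : ℕ → ℝ := fun s => Y s ω

/-- The well-specified fixed-design logistic model: under `P` the responses `Y_1, Y_2, …` are
independent, with values in `{0, 1}`, and `P(Y_t = 1) = b'(⟨x_t, θ_⋆⟩)`. -/
structure LogisticModel {p : ℕ} {S : Type*} [MeasurableSpace S] (P : Measure S)
    (x : ℕ → Param p) (θstar : Param p) (Y : ℕ → S → ℝ) : Prop where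
  measurable : ∀ t, 1 ≤ t → Measurable (Y t)
  indep : iIndepFun (fun t : ℕ => Y (t + 1)) P
  prob_one : ∀ t, 1 ≤ t → P.real {ω | Y t ω = 1} = deriv softplus (inner ℝ (x t) θstar)
  prob_zero : ∀ t, 1 ≤ t → P.real {ω | Y t ω = 0} = 1 - deriv softplus (inner ℝ (x t) θstar)

/-- The condition on the design and on the batch MAP estimator, with constants `Kmin` and `Kmax`. -/
structure CondEx {p : ℕ} {S : Type*} [MeasurableSpace S] (P : Measure S)
    (x : ℕ → Param p) (θstar : Param p) (Y : ℕ → S → ℝ) (θ₀ : Param p) (Om₀ : Mat p)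
    (xx r Kmin Kmax : ℝ) : Prop where
  norm_le : ∀ t : ℕ, 1 ≤ t → max 1 r * ‖x t‖ ≤ Kmax
  lamMin_ge : ∀ t : ℕ, 1 ≤ t → Kmax * p ≤ t →
    Kmin * t ≤ lamMin (∑ s ∈ goodIdx x θstar Kmax t, outer (x s))
  lamMax_le : ∀ t : ℕ, 1 ≤ t → Kmax * p ≤ t →
    lamMax (∑ s ∈ Finset.Icc 1 t, outer (x s)) ≤ Kmax * t
  map_mem : ∀ t₀ : ℕ, 1 ≤ t₀ → Kmax * (p + xx) ≤ t₀ →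
    1 - Real.exp (-xx) ≤
      P.real {ω | mapEst x (path Y ω) θ₀ Om₀ t₀ ∈ localSet θstar r}

end OnlineLogit

end

/-! The deterministic claims rest on one scalar fact: moving `u` to `v` changes `sigmoid` and `1 -
sigmoid` by a factor at most `exp |u - v|`, so the weight `wt` changes by at most `exp (2|u - v|)`
(`wt_le_exp_mul`). Every Hessian is `wt ⟨x, θ⟩ • x xᵀ` and does not involve the response. Over `Θ_r`
the inner product moves by at most `r‖x‖ ≤ Kmax`, so covariates with `|⟨x, θ⋆⟩| ≤ Kmax` keep a
weight bounded away from zero. This gives the linear growth of the curvature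
(`mul_norm_sq_le_quadForm_sum_hess`).

The two random sums are controlled by nonnegative supermartingales and Ville's inequality at level
`exp xx`. The exponential of the excess loss is a likelihood ratio of the one-step-ahead predictions
against the truth, with conditional mean exactly one (`likelihood_ratio_mean`). The decrement `⟨g,
Ω⁻¹g⟩` equals the squared residual times the leverage `⟨x, Ω⁻¹x⟩`. The leverage is predictable,
because `Ω_s` does not see `Y_s`. Before the exit time the squared residual has conditional mean at
most a constant times `wt`, so the decrement minus a constant times the weighted leverage has
exponential moment at most one (`squared_residual_mgf_le`).

The weighted leverages are summed by a log-determinant potential: each is at most one increment of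
`log det Ω` (`sum_leverage_le_log_det`), and the total growth is of order `p log t`
(`log_det_prec_sub_le`). Both the bound on the leverages and this growth bound use that `Ω_{t₀}`
contains the Fisher information at a MAP estimate lying in `Θ_r`. The failure of that membership and
the two Ville events are the three exceptional events. -/

namespace OnlineLogit

/-! ### Scalar estimates for the sigmoid and the softplus -/

/-- The second derivative of `softplus`. -/
noncomputable def wt (u : ℝ) : ℝ := Real.sigmoid u * (1 - Real.sigmoid u)

theorem sigmoid_eq_div (u : ℝ) : Real.sigmoid u = Real.exp u / (1 + Real.exp u) := by
  rw [Real.sigmoid_def, Real.exp_neg]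
  have := Real.exp_pos u
  field_simp
  ring

theorem hasDerivAt_softplus (u : ℝ) : HasDerivAt softplus (Real.sigmoid u) u := by
  have h : HasDerivAt (fun u : ℝ => 1 + Real.exp u) (Real.exp u) u :=
    (Real.hasDerivAt_exp u).const_add 1
  rw [sigmoid_eq_div]
  exact h.log (by positivity)

theorem deriv_softplus (u : ℝ) : deriv softplus u = Real.sigmoid u :=
  (hasDerivAt_softplus u).deriv

theorem one_sub_sigmoid_pos (u : ℝ) : 0 < 1 - Real.sigmoid u :=
  sub_pos.2 (Real.sigmoid_lt_one u)

theorem wt_pos (u : ℝ) : 0 < wt u := mul_pos (Real.sigmoid_pos u) (one_sub_sigmoid_pos u)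

theorem wt_le_quarter (u : ℝ) : wt u ≤ 1 / 4 := by
  unfold wt
  nlinarith [sq_nonneg (Real.sigmoid u - 1 / 2)]

theorem hasDerivAt_sigmoid_wt (u : ℝ) : HasDerivAt Real.sigmoid (wt u) u :=
  Real.hasDerivAt_sigmoid u

/-- The logarithm of the sigmoid is 1-Lipschitz. Here this is read off from the denominators `1 +
exp (-u)` and `1 + exp (-v)`, compared term by term. -/
theorem sigmoid_le_exp_mul (u v : ℝ) :
    Real.sigmoid u ≤ Real.exp |u - v| * Real.sigmoid v := by
  have h1 : Real.exp (-v) ≤ Real.exp |u - v| * Real.exp (-u) := by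
    rw [← Real.exp_add]
    exact Real.exp_le_exp.2 (by linarith [le_abs_self (u - v)])
  have h2 : 1 ≤ Real.exp |u - v| := Real.one_le_exp (abs_nonneg _)
  rw [Real.sigmoid_def, Real.sigmoid_def, ← div_eq_mul_inv, inv_eq_one_div,
    div_le_div_iff₀ (by positivity) (by positivity)]
  nlinarith [Real.exp_pos (-u)]

theorem one_sub_sigmoid_le_exp_mul (u v : ℝ) :
    1 - Real.sigmoid u ≤ Real.exp |u - v| * (1 - Real.sigmoid v) := by
  have := sigmoid_le_exp_mul (-u) (-v)
  rwa [Real.sigmoid_neg, Real.sigmoid_neg, neg_sub_neg, abs_sub_comm] at this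

theorem wt_le_exp_mul (u v : ℝ) : wt u ≤ Real.exp (2 * |u - v|) * wt v := by
  have h := mul_le_mul (sigmoid_le_exp_mul u v) (one_sub_sigmoid_le_exp_mul u v)
    (one_sub_sigmoid_pos u).le (by have := Real.sigmoid_pos v; positivity)
  calc wt u ≤ _ := h
    _ = (Real.exp |u - v| * Real.exp |u - v|) * wt v := by unfold wt; ring
    _ = _ := by rw [← Real.exp_add, two_mul]

theorem wt_ge_of_abs_le {u M : ℝ} (h : |u| ≤ M) : Real.exp (-(2 * M)) / 4 ≤ wt u := by
  have h1 := wt_le_exp_mul 0 u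
  have h0 : wt 0 = 1 / 4 := by unfold wt; rw [Real.sigmoid_zero]; norm_num
  rw [h0, zero_sub, abs_neg] at h1
  have h2 : Real.exp (2 * |u|) ≤ Real.exp (2 * M) := Real.exp_le_exp.2 (by linarith)
  rw [Real.exp_neg, div_le_iff₀ (by norm_num), inv_le_iff_one_le_mul₀ (Real.exp_pos _)]
  nlinarith [wt_pos u]

theorem abs_sigmoid_sub_le (u v : ℝ) : |Real.sigmoid u - Real.sigmoid v| ≤ |u - v| := by
  have := Convex.norm_image_sub_le_of_norm_hasDerivWithin_le (f := Real.sigmoid) (f' := wt)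
    (s := Set.univ) (C := 1) (x := v) (y := u)
    (fun x _ => (hasDerivAt_sigmoid_wt x).hasDerivWithinAt)
    (fun x _ => by
      rw [Real.norm_of_nonneg (wt_pos x).le]
      linarith [wt_le_quarter x]) convex_univ (Set.mem_univ _) (Set.mem_univ _)
  simpa using this

theorem abs_wt_sub_le (u v : ℝ) : |wt u - wt v| ≤ |u - v| := by
  have e : wt u - wt v =
      (Real.sigmoid u - Real.sigmoid v) * (1 - Real.sigmoid u - Real.sigmoid v) := by
    unfold wt; ring
  rw [e, abs_mul]
  have h1 : |1 - Real.sigmoid u - Real.sigmoid v| ≤ 1 := by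
    rw [abs_le]
    constructor <;> linarith [Real.sigmoid_pos u, Real.sigmoid_pos v, Real.sigmoid_lt_one u,
      Real.sigmoid_lt_one v]
  exact (mul_le_of_le_one_right (abs_nonneg _) h1).trans (abs_sigmoid_sub_le u v)

theorem iteratedDeriv_two_softplus (u : ℝ) : iteratedDeriv 2 softplus u = wt u := by
  rw [iteratedDeriv_succ, iteratedDeriv_one]
  have : deriv softplus = Real.sigmoid := funext deriv_softplus
  rw [this]
  exact (hasDerivAt_sigmoid_wt u).deriv

theorem contDiff_softplus : ContDiff ℝ 2 softplus := by
  unfold softplus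
  exact ContDiff.log (by fun_prop) (fun u => by positivity)

theorem softplus_taylor (u v : ℝ) : ∃ τ ∈ Set.Icc (0 : ℝ) 1,
    softplus u = softplus v + Real.sigmoid v * (u - v)
      + 1 / 2 * wt (v + τ * (u - v)) * (u - v) ^ 2 := by
  by_cases huv : v = u
  · exact ⟨0, by simp, by simp [huv]⟩
  obtain ⟨w, hw, h⟩ := taylor_mean_remainder_lagrange_iteratedDeriv (n := 1) huv
    (contDiff_softplus.contDiffOn)
  have hne : u - v ≠ 0 := sub_ne_zero.2 (Ne.symm huv)
  have hd : derivWithin softplus (Set.uIcc v u) v = Real.sigmoid v :=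
    (hasDerivAt_softplus v).hasDerivWithinAt.derivWithin
      (uniqueDiffOn_uIcc huv v Set.left_mem_uIcc)
  rw [taylorWithinEval_succ, taylor_within_zero_eval, iteratedDerivWithin_one, hd] at h
  refine ⟨(w - v) / (u - v), ?_, ?_⟩
  · rcases lt_or_gt_of_ne huv with hlt | hlt
    · rw [Set.uIoo_of_lt hlt] at hw
      have : 0 < u - v := by linarith
      exact ⟨div_nonneg (by linarith [hw.1]) this.le, (div_le_one this).2 (by linarith [hw.2])⟩
    · rw [Set.uIoo_of_gt hlt] at hw
      have : u - v < 0 := by linarith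
      exact ⟨div_nonneg_of_nonpos (by linarith [hw.2]) this.le,
        (div_le_one_of_neg this).2 (by linarith [hw.1])⟩
  · rw [div_mul_cancel₀ _ hne, add_sub_cancel]
    rw [iteratedDeriv_two_softplus] at h
    norm_num [Nat.factorial] at h
    linarith

/-- The likelihood ratio of two logistic models has mean one under the second one. -/
theorem likelihood_ratio_mean (u v : ℝ) :
    Real.sigmoid v * Real.exp ((softplus v - 1 * v) - (softplus u - 1 * u))
      + (1 - Real.sigmoid v) * Real.exp ((softplus v - 0 * v) - (softplus u - 0 * u)) = 1 := by
  have e : ∀ w, Real.exp (softplus w) = 1 + Real.exp w := fun w =>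
    Real.exp_log (by positivity)
  simp only [one_mul, zero_mul, sub_zero, Real.exp_sub, e, sigmoid_eq_div]
  have h1 := Real.exp_pos u
  have h2 := Real.exp_pos v
  field_simp
  ring

/-- If the response had parameter `u`, the mean squared residual would be exactly the Bernoulli
variance `wt u`. Replacing the true probabilities at `v` by those at `u` costs a factor `exp M`. -/
theorem squared_residual_mean_le {u v M : ℝ} (h : |u - v| ≤ M) :
    Real.sigmoid v * (Real.sigmoid u - 1) ^ 2 + (1 - Real.sigmoid v) * (Real.sigmoid u - 0) ^ 2
      ≤ Real.exp M * wt u := by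
  have hM : Real.exp |v - u| ≤ Real.exp M := Real.exp_le_exp.2 (by rwa [abs_sub_comm])
  have hu := Real.sigmoid_pos u
  have hu' := one_sub_sigmoid_pos u
  have h1 : Real.sigmoid v ≤ Real.exp M * Real.sigmoid u :=
    (sigmoid_le_exp_mul v u).trans (by gcongr)
  have h2 : 1 - Real.sigmoid v ≤ Real.exp M * (1 - Real.sigmoid u) :=
    (one_sub_sigmoid_le_exp_mul v u).trans (by gcongr)
  calc _ ≤ Real.exp M * Real.sigmoid u * (Real.sigmoid u - 1) ^ 2
        + Real.exp M * (1 - Real.sigmoid u) * (Real.sigmoid u - 0) ^ 2 := by gcongr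
    _ = Real.exp M * wt u := by unfold wt; ring

theorem exp_le_one_add_exp_mul {w B : ℝ} (hw : 0 ≤ w) (hB : w ≤ B) :
    Real.exp w ≤ 1 + Real.exp B * w := by
  have h1 : Real.exp w ≤ 1 + Real.exp w * w := by
    have := Real.add_one_le_exp (-w)
    rw [Real.exp_neg] at this
    have hp := Real.exp_pos w
    have h3 := mul_le_mul_of_nonneg_left this hp.le
    rw [mul_inv_cancel₀ hp.ne'] at h3
    linarith
  have : Real.exp w * w ≤ Real.exp B * w := by gcongr
  linarith

/-- Residuals are at most one in absolute value, so both exponents lie in `[0, B]`, where the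
exponential is below a linear function. Only the second moment is then needed, and `1 + a ≤ exp a`
restores an exponential. -/
theorem squared_residual_mgf_le {u v M z B : ℝ} (h : |u - v| ≤ M) (hz : 0 ≤ z) (hB : z ≤ B) :
    Real.sigmoid v * Real.exp ((Real.sigmoid u - 1) ^ 2 * z)
      + (1 - Real.sigmoid v) * Real.exp ((Real.sigmoid u - 0) ^ 2 * z)
      ≤ Real.exp (Real.exp (B + M) * (wt u * z)) := by
  have hu := Real.sigmoid_pos u
  have hu' := Real.sigmoid_lt_one u
  have hv := Real.sigmoid_pos v
  have hv' := one_sub_sigmoid_pos v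
  have b1 : (Real.sigmoid u - 1) ^ 2 * z ≤ B :=
    (mul_le_of_le_one_left hz (by nlinarith)).trans hB
  have b0 : (Real.sigmoid u - 0) ^ 2 * z ≤ B :=
    (mul_le_of_le_one_left hz (by nlinarith)).trans hB
  have k1 := exp_le_one_add_exp_mul (by positivity) b1
  have k0 := exp_le_one_add_exp_mul (by positivity) b0
  calc _ ≤ Real.sigmoid v * (1 + Real.exp B * ((Real.sigmoid u - 1) ^ 2 * z))
        + (1 - Real.sigmoid v) * (1 + Real.exp B * ((Real.sigmoid u - 0) ^ 2 * z)) := by gcongr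
    _ = 1 + Real.exp B * z * (Real.sigmoid v * (Real.sigmoid u - 1) ^ 2
        + (1 - Real.sigmoid v) * (Real.sigmoid u - 0) ^ 2) := by ring
    _ ≤ 1 + Real.exp B * z * (Real.exp M * wt u) := by
        gcongr
        exact squared_residual_mean_le h
    _ = Real.exp (B + M) * (wt u * z) + 1 := by rw [Real.exp_add]; ring
    _ ≤ _ := Real.add_one_le_exp _

/-! ### Quadratic forms, rank-one matrices and the Loewner order -/

section QuadForm

open Matrix

variable {p : ℕ}

theorem quadForm_eq_dotProduct (A : Mat p) (v : Param p) :
    quadForm A v = v.ofLp ⬝ᵥ A *ᵥ v.ofLp :=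
  Matrix.inner_toEuclideanCLM A v v

theorem quadForm_add (A B : Mat p) (v : Param p) :
    quadForm (A + B) v = quadForm A v + quadForm B v := by
  simp only [quadForm_eq_dotProduct, add_mulVec, dotProduct_add]

theorem quadForm_sub (A B : Mat p) (v : Param p) :
    quadForm (A - B) v = quadForm A v - quadForm B v := by
  simp only [quadForm_eq_dotProduct, sub_mulVec, dotProduct_sub]

theorem quadForm_smul (c : ℝ) (A : Mat p) (v : Param p) :
    quadForm (c • A) v = c * quadForm A v := by
  simp only [quadForm_eq_dotProduct, smul_mulVec, dotProduct_smul, smul_eq_mul]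

theorem quadForm_smul_vec (A : Mat p) (c : ℝ) (v : Param p) :
    quadForm A (c • v) = c ^ 2 * quadForm A v := by
  unfold quadForm
  rw [map_smul, inner_smul_left, inner_smul_right]
  simp; ring

theorem quadForm_sum {ι : Type*} (s : Finset ι) (A : ι → Mat p) (v : Param p) :
    quadForm (∑ i ∈ s, A i) v = ∑ i ∈ s, quadForm (A i) v := by
  classical
  induction s using Finset.induction_on with
  | empty => simp [quadForm_eq_dotProduct]
  | insert a s ha ih => rw [Finset.sum_insert ha, Finset.sum_insert ha, quadForm_add, ih]

theorem inner_eq_dotProduct (v w : Param p) : inner ℝ v w = v.ofLp ⬝ᵥ w.ofLp := by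
  rw [EuclideanSpace.inner_eq_star_dotProduct, dotProduct_comm]
  simp

theorem outer_eq_vecMulVec (x : Param p) : outer x = vecMulVec x.ofLp x.ofLp := rfl

theorem toOp_outer (x v : Param p) : toOp (outer x) v = (inner ℝ x v : ℝ) • x := by
  ext i
  simp only [toOp, Matrix.ofLp_toEuclideanCLM, outer_eq_vecMulVec, vecMulVec_mulVec,
    inner_eq_dotProduct]
  simp [mul_comm]

theorem quadForm_outer (x v : Param p) : quadForm (outer x) v = (inner ℝ x v) ^ 2 := by
  rw [quadForm, toOp_outer, inner_smul_right, real_inner_comm x v, sq]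

theorem quadForm_outer_le (x v : Param p) : quadForm (outer x) v ≤ ‖x‖ ^ 2 * ‖v‖ ^ 2 := by
  rw [quadForm_outer, ← mul_pow, ← sq_abs]
  gcongr
  exact abs_real_inner_le_norm x v

theorem outer_isHermitian (x : Param p) : (outer x).IsHermitian := by
  ext i j
  simp [outer, mul_comm]

theorem posSemidef_iff_quadForm {A : Mat p} :
    A.PosSemidef ↔ A.IsHermitian ∧ ∀ v, 0 ≤ quadForm A v := by
  rw [Matrix.posSemidef_iff_dotProduct_mulVec]
  refine and_congr_right fun _ => ⟨fun h v => ?_, fun h v => ?_⟩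
  · rw [quadForm_eq_dotProduct]
    simpa using h v.ofLp
  · simpa [quadForm_eq_dotProduct] using h (WithLp.toLp 2 v)

theorem outer_posSemidef (x : Param p) : (outer x).PosSemidef :=
  posSemidef_iff_quadForm.2 ⟨outer_isHermitian x, fun v => by
    rw [quadForm_outer]; positivity⟩

theorem quadForm_nonneg {A : Mat p} (hA : A.PosSemidef) (v : Param p) : 0 ≤ quadForm A v :=
  (posSemidef_iff_quadForm.1 hA).2 v

theorem loewnerLE_of_quadForm_le {A B : Mat p} (hA : A.IsHermitian) (hB : B.IsHermitian)
    (h : ∀ v, quadForm A v ≤ quadForm B v) : LoewnerLE A B :=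
  posSemidef_iff_quadForm.2 ⟨hB.sub hA, fun v => by rw [quadForm_sub]; linarith [h v]⟩

theorem norm_toOp_outer_le (x : Param p) : ‖toOp (outer x)‖ ≤ ‖x‖ ^ 2 := by
  refine ContinuousLinearMap.opNorm_le_bound _ (by positivity) fun v => ?_
  rw [toOp_outer, norm_smul, Real.norm_eq_abs]
  calc _ ≤ (‖x‖ * ‖v‖) * ‖x‖ := by gcongr; exact abs_real_inner_le_norm x v
    _ = _ := by ring

theorem opNorm_smul_outer_le (c : ℝ) (x : Param p) : opNorm (c • outer x) ≤ |c| * ‖x‖ ^ 2 := by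
  unfold opNorm toOp
  rw [map_smul, norm_smul, Real.norm_eq_abs]
  gcongr
  exact norm_toOp_outer_le x

end QuadForm

/-! ### The smallest singular value as a bound on the quadratic form -/

section SingularValues

open Matrix

variable {p : ℕ}

theorem mul_norm_sq_le_inner_of_eigenvalues {E : Type*} [NormedAddCommGroup E]
    [InnerProductSpace ℝ E] [FiniteDimensional ℝ E] {T : E →ₗ[ℝ] E} (hT : T.IsSymmetric) {m : ℝ}
    (h : ∀ i, m ≤ hT.eigenvalues rfl i) (v : E) : m * ‖v‖ ^ 2 ≤ inner ℝ v (T v) := by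
  set b := hT.eigenvectorBasis rfl
  have e1 := b.sum_inner_mul_inner v v
  have e2 := b.sum_inner_mul_inner v (T v)
  rw [← e2, ← real_inner_self_eq_norm_sq, ← e1, Finset.mul_sum]
  refine Finset.sum_le_sum fun i _ => ?_
  have : inner ℝ (b i) (T v) = hT.eigenvalues rfl i * inner ℝ (b i) v := by
    rw [← hT, hT.apply_eigenvectorBasis, inner_smul_left]
    simp [b]
  rw [this, real_inner_comm v]
  nlinarith [h i, sq_nonneg (inner ℝ (b i) v : ℝ), real_inner_comm v (b i)]

theorem finrank_param : Module.finrank ℝ (Param p) = p := by simp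

/-- For a positive semidefinite operator `T`, an eigenvalue `μ ≥ 0` gives the eigenvalue `μ ^ 2` of
`T* T`. So `μ` is itself a singular value, hence no smaller than the last one. -/
theorem mul_norm_sq_le_quadForm_of_le_lamMin {A : Mat p} (hA : A.PosSemidef) {m : ℝ}
    (hm : m ≤ lamMin A) (v : Param p) : m * ‖v‖ ^ 2 ≤ quadForm A v := by
  have hsym : (toOp A : Param p →ₗ[ℝ] Param p).IsSymmetric :=
    Matrix.isSymmetric_toEuclideanLin_iff.2 hA.isHermitian
  set T := (toOp A : Param p →ₗ[ℝ] Param p) with hT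
  refine mul_norm_sq_le_inner_of_eigenvalues hsym (fun i => ?_) v
  set μ := hsym.eigenvalues rfl i with hμ
  set w := hsym.eigenvectorBasis rfl i with hw
  have hTw : T w = μ • w := hsym.apply_eigenvectorBasis rfl i
  have hwn : ‖w‖ = 1 := (hsym.eigenvectorBasis rfl).norm_eq_one i
  have hμ0 : 0 ≤ μ := by
    have h1 : quadForm A w = μ := by
      change inner ℝ w (T w) = μ
      rw [hTw, inner_smul_right, real_inner_self_eq_norm_sq, hwn]
      ring
    exact h1 ▸ quadForm_nonneg hA w
  have hadj : LinearMap.adjoint T = T :=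
    (LinearMap.isSymmetric_iff_isSelfAdjoint T).1 hsym
  have hev : Module.End.HasEigenvalue (LinearMap.adjoint T ∘ₗ T) (μ ^ 2) := by
    refine Module.End.hasEigenvalue_of_hasEigenvector (x := w) ⟨?_, ?_⟩
    · rw [Module.End.mem_eigenspace_iff, hadj, LinearMap.comp_apply, hTw, map_smul, hTw, smul_smul,
        sq]
    · exact norm_ne_zero_iff.1 (by rw [hwn]; exact one_ne_zero)
  obtain ⟨j, hj⟩ := T.isSymmetric_adjoint_comp_self.exists_eigenvalues_eq finrank_param hev
  have hj' : T.singularValues j ^ 2 = μ ^ 2 := by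
    rw [T.sq_singularValues_fin finrank_param j]
    exact_mod_cast hj
  have hle : T.singularValues (p - 1) ≤ T.singularValues j :=
    T.singularValues_antitone (by have := j.isLt; omega)
  have := (sq_eq_sq₀ (T.singularValues_nonneg j) hμ0).1 hj'
  exact hm.trans (hle.trans this.le)

/-- A singular vector attains `‖T v‖ = σ ‖v‖`, and Cauchy–Schwarz bounds the quadratic form there by
`σ ‖v‖ ^ 2`. Symmetry plays no role. -/
theorem le_lamMin_of_quadForm (hp : 1 ≤ p) {A : Mat p} {m : ℝ}
    (h : ∀ v, m * ‖v‖ ^ 2 ≤ quadForm A v) : m ≤ lamMin A := by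
  set T := (toOp A : Param p →ₗ[ℝ] Param p) with hT
  obtain ⟨v, hv⟩ := (T.hasEigenvalue_adjoint_comp_self_sq_singularValues (n := p - 1)
    (by rw [finrank_param]; omega)).exists_hasEigenvector
  have hv0 : 0 < ‖v‖ := norm_pos_iff.2 hv.2
  have h1 : ‖T v‖ ^ 2 = (T.singularValues (p - 1) * ‖v‖) ^ 2 := by
    have := hv.apply_eq_smul
    rw [← real_inner_self_eq_norm_sq, ← LinearMap.adjoint_inner_right,
      ← LinearMap.comp_apply, this, inner_smul_right, real_inner_self_eq_norm_sq]
    simp only [RCLike.ofReal_real_eq_id, id]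
    ring
  have h2 : ‖T v‖ = T.singularValues (p - 1) * ‖v‖ :=
    (sq_eq_sq₀ (norm_nonneg _) (mul_nonneg (T.singularValues_nonneg _) hv0.le)).1 h1
  have h3 : quadForm A v ≤ ‖v‖ * ‖T v‖ := real_inner_le_norm v (T v)
  rw [h2] at h3
  have h4 := (h v).trans h3
  change m ≤ T.singularValues (p - 1)
  have : 0 < ‖v‖ ^ 2 := by positivity
  nlinarith

end SingularValues

/-! ### Determinant comparison and rank-one updates -/

section Det

open Matrix
open scoped MatrixOrder Matrix.Norms.L2Operator

variable {p : ℕ}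

/-- Factor `A = yᵀ y`. The congruence `y⁻ᵀ B y⁻¹` has determinant `det B / det A`, and its
eigenvalues are values of the form of `B` at vectors where the form of `A` equals one, so they lie
in `[0, c]`. -/
theorem det_le_pow_mul_det {A B : Mat p} (hA : A.PosDef) (hB : B.PosSemidef) {c : ℝ}
    (h : ∀ v, quadForm B v ≤ c * quadForm A v) : B.det ≤ c ^ p * A.det := by
  obtain ⟨y, hy⟩ := CStarAlgebra.nonneg_iff_eq_star_mul_self.mp hA.posSemidef.nonneg
  rw [star_eq_conjTranspose] at hy
  have hdet : A.det = y.det * y.det := by rw [hy, det_mul, det_conjTranspose, star_trivial]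
  have hy0 : y.det ≠ 0 := by
    intro h0
    have := hA.det_pos
    rw [hdet, h0] at this
    simp at this
  have hyu : IsUnit y.det := hy0.isUnit
  have hM : (y⁻¹ᴴ * B * y⁻¹).PosSemidef := hB.conjTranspose_mul_mul_same y⁻¹
  have hMdet : (y⁻¹ᴴ * B * y⁻¹).det * A.det = B.det := by
    rw [det_mul, det_mul, det_conjTranspose, star_trivial, hdet, det_nonsing_inv,
      Ring.inverse_eq_inv']
    field_simp
  have hev : ∀ i, hM.1.eigenvalues i ≤ c := by
    intro i
    set w := hM.1.eigenvectorBasis i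
    have hwn : ‖w‖ = 1 := hM.1.eigenvectorBasis.norm_eq_one i
    have e1 : hM.1.eigenvalues i = quadForm B (WithLp.toLp 2 (y⁻¹ *ᵥ w.ofLp)) := by
      rw [hM.1.eigenvalues_eq, quadForm_eq_dotProduct]
      simp only [star_trivial, RCLike.re_to_real, conjTranspose_eq_transpose_of_trivial]
      rw [← mulVec_mulVec, ← mulVec_mulVec, mulVec_transpose, dotProduct_comm,
        ← dotProduct_mulVec, dotProduct_comm]
      rfl
    have e2 : quadForm A (WithLp.toLp 2 (y⁻¹ *ᵥ w.ofLp)) = 1 := by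
      have : y *ᵥ (y⁻¹ *ᵥ w.ofLp) = w.ofLp := by
        rw [mulVec_mulVec, mul_nonsing_inv _ hyu, one_mulVec]
      rw [quadForm_eq_dotProduct, hy, ← mulVec_mulVec, this,
        conjTranspose_eq_transpose_of_trivial, mulVec_transpose, dotProduct_comm,
        ← dotProduct_mulVec, this, ← inner_eq_dotProduct, real_inner_self_eq_norm_sq, hwn]
      norm_num
    rw [e1]
    exact (h _).trans (by rw [e2, mul_one])
  have hMle : (y⁻¹ᴴ * B * y⁻¹).det ≤ c ^ p := by
    rw [hM.1.det_eq_prod_eigenvalues]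
    calc _ ≤ ∏ _i : Fin p, c := Finset.prod_le_prod (fun i _ => hM.eigenvalues_nonneg i)
          fun i _ => hev i
      _ = c ^ p := by simp
  rw [← hMdet]
  exact mul_le_mul_of_nonneg_right hMle hA.det_pos.le

/-- The determinant lemma for removing a rank-one term. -/
theorem det_sub_smul_outer {A : Mat p} (hA : A.PosDef) (c : ℝ) (x : Param p) :
    (A - c • outer x).det = A.det * (1 - c * quadForm A⁻¹ x) := by
  have h := det_add_replicateCol_mul_replicateRow (ι := Unit) (A := A) hA.det_pos.ne'.isUnit
    ((-c) • x.ofLp) x.ofLp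
  have e : A + replicateCol Unit ((-c) • x.ofLp) * replicateRow Unit x.ofLp
      = A - c • outer x := by
    ext i j
    simp [outer, Matrix.mul_apply]
    ring
  rw [e] at h
  rw [h, quadForm_eq_dotProduct, det_unique (n := Unit)]
  congr 1
  rw [Matrix.add_apply, one_apply_eq, ← replicateRow_vecMul, Matrix.replicateRow_mul_replicateCol_apply, ← dotProduct_mulVec,
    mulVec_smul, dotProduct_smul, smul_eq_mul]
  ring

/-- The inverse is taken after the update, so the determinant lemma gives the ratio old over new as
`1 - q`, with `q` the left side. The claim is then `q ≤ -log (1 - q)`. -/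
theorem mul_quadForm_inv_le_log_det {A : Mat p} (hA : A.PosDef) {c : ℝ} (hc : 0 ≤ c)
    (x : Param p) :
    c * quadForm (A + c • outer x)⁻¹ x
      ≤ Real.log (A + c • outer x).det - Real.log A.det := by
  have hB : (A + c • outer x).PosDef := hA.add_posSemidef ((outer_posSemidef x).smul hc)
  have h := det_sub_smul_outer hB c x
  rw [add_sub_cancel_right] at h
  have hq : 0 < 1 - c * quadForm (A + c • outer x)⁻¹ x := by
    have := hA.det_pos
    rw [h] at this
    exact pos_of_mul_pos_right this hB.det_pos.le
  rw [h, Real.log_mul hB.det_pos.ne' hq.ne']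
  linarith [Real.log_le_sub_one_of_pos hq]

/-- If `m ≤ A` in the Loewner order then `A⁻¹ ≤ m⁻¹`. -/
theorem quadForm_inv_le {A : Mat p} (hA : A.PosDef) {m : ℝ} (hm : 0 < m)
    (h : ∀ v, m * ‖v‖ ^ 2 ≤ quadForm A v) (x : Param p) : quadForm A⁻¹ x ≤ ‖x‖ ^ 2 / m := by
  set y := toOp A⁻¹ x with hy
  have hAy : toOp A y = x := by
    have : toOp A (toOp A⁻¹ x) = (toOp A * toOp A⁻¹) x := rfl
    rw [hy, this, ← map_mul, mul_nonsing_inv _ hA.det_pos.ne'.isUnit, map_one]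
    rfl
  have h1 : m * ‖y‖ ^ 2 ≤ inner ℝ y x := by
    have := h y
    rwa [quadForm, hAy] at this
  have h2 : quadForm A⁻¹ x = inner ℝ x y := rfl
  have h3 := real_inner_le_norm x y
  rw [real_inner_comm] at h1
  rw [h2, le_div_iff₀ hm]
  have hx := norm_nonneg x
  have hyn := norm_nonneg y
  have h4 : m * ‖y‖ ≤ ‖x‖ := by
    by_contra! hlt
    have : 0 < ‖y‖ := by
      by_contra! h0
      have : ‖y‖ = 0 := le_antisymm h0 hyn
      rw [this] at hlt; linarith
    nlinarith
  nlinarith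

end Det

/-! ### Derivatives and local curvature of the logistic loss -/

section Loss

variable {p : ℕ}

theorem hasFDerivAt_loss (x : Param p) (y : ℝ) (θ : Param p) :
    HasFDerivAt (loss x y) ((Real.sigmoid (inner ℝ x θ) - y) • innerSL ℝ x) θ := by
  have h1 : HasFDerivAt (fun η : Param p => (inner ℝ x η : ℝ)) (innerSL ℝ x) θ :=
    (innerSL ℝ x).hasFDerivAt
  have h2 := (hasDerivAt_softplus (inner ℝ x θ)).comp_hasFDerivAt θ h1
  have h3 := h2.sub (h1.const_mul y)
  rw [sub_smul]
  exact h3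

theorem gradient_loss (x : Param p) (y : ℝ) (θ : Param p) :
    gradient (loss x y) θ = (Real.sigmoid (inner ℝ x θ) - y) • x := by
  refine HasGradientAt.gradient ?_
  have e : InnerProductSpace.toDual ℝ (Param p) ((Real.sigmoid (inner ℝ x θ) - y) • x)
      = (Real.sigmoid (inner ℝ x θ) - y) • innerSL ℝ x := by
    rw [map_smulₛₗ]
    rfl
  rw [hasGradientAt_iff_hasFDerivAt, e]
  exact hasFDerivAt_loss x y θ

theorem hess_loss (x : Param p) (y : ℝ) (θ : Param p) :
    hess (loss x y) θ = wt (inner ℝ x θ) • outer x := by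
  ext i j
  have h1 : (fun η => fderiv ℝ (loss x y) η (EuclideanSpace.single j 1))
      = fun η => (Real.sigmoid (inner ℝ x η) - y) * x j := by
    ext η
    rw [(hasFDerivAt_loss x y η).fderiv]
    simp [EuclideanSpace.inner_single_right]
  have h2 : HasFDerivAt (fun η : Param p => (inner ℝ x η : ℝ)) (innerSL ℝ x) θ :=
    (innerSL ℝ x).hasFDerivAt
  have h3 := (((hasDerivAt_sigmoid_wt (inner ℝ x θ)).comp_hasFDerivAt θ h2).sub_const
    y).mul_const (x j)
  simp only [hess, Matrix.of_apply, h1, Matrix.smul_apply, outer]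
  erw [h3.fderiv]
  simp [EuclideanSpace.inner_single_right]
  ring

theorem abs_inner_sub_inner_le (x θ θ' : Param p) :
    |(inner ℝ x θ : ℝ) - inner ℝ x θ'| ≤ ‖x‖ * ‖θ - θ'‖ := by
  rw [← inner_sub_right]
  exact abs_real_inner_le_norm _ _

theorem convex_localSet (θstar : Param p) (r : ℝ) : Convex ℝ (localSet θstar r) := by
  have : localSet θstar r = Metric.closedBall θstar r := by
    ext θ; simp [localSet, dist_eq_norm]
  rw [this]
  exact convex_closedBall _ _

theorem hess_loss_posSemidef (x : Param p) (y : ℝ) (θ : Param p) :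
    (hess (loss x y) θ).PosSemidef := by
  rw [hess_loss]
  exact (outer_posSemidef x).smul (wt_pos _).le

theorem opNorm_hess_loss_le (x : Param p) (y : ℝ) (θ : Param p) :
    opNorm (hess (loss x y) θ) ≤ ‖x‖ ^ 2 := by
  rw [hess_loss]
  refine (opNorm_smul_outer_le _ _).trans (mul_le_of_le_one_left (by positivity) ?_)
  rw [abs_of_pos (wt_pos _)]
  linarith [wt_le_quarter (inner ℝ x θ)]

theorem opNorm_hess_loss_sub_le (x : Param p) (y : ℝ) (θ θ' : Param p) :
    opNorm (hess (loss x y) θ - hess (loss x y) θ') ≤ ‖x‖ ^ 3 * ‖θ - θ'‖ := by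
  rw [hess_loss, hess_loss, ← sub_smul]
  refine (opNorm_smul_outer_le _ _).trans ?_
  calc _ ≤ (‖x‖ * ‖θ - θ'‖) * ‖x‖ ^ 2 := by
        gcongr
        exact (abs_wt_sub_le _ _).trans (abs_inner_sub_inner_le _ _ _)
    _ = _ := by ring

theorem quadForm_hess_loss (x : Param p) (y : ℝ) (θ v : Param p) :
    quadForm (hess (loss x y) θ) v = wt (inner ℝ x θ) * (inner ℝ x v) ^ 2 := by
  rw [hess_loss, quadForm_smul, quadForm_outer]

theorem quadForm_hess_loss_le_exp_mul (x : Param p) (y : ℝ) (θ θ' v : Param p) :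
    quadForm (hess (loss x y) θ) v
      ≤ Real.exp (2 * (‖x‖ * ‖θ - θ'‖)) * quadForm (hess (loss x y) θ') v := by
  rw [quadForm_hess_loss, quadForm_hess_loss, ← mul_assoc]
  gcongr
  refine (wt_le_exp_mul _ (inner ℝ x θ')).trans ?_
  have := (wt_pos (inner ℝ x θ')).le
  gcongr
  exact abs_inner_sub_inner_le _ _ _

theorem fisher_posSemidef (x : ℕ → Param p) (y : ℕ → ℝ) (t : ℕ) (θ : Param p) :
    (fisher x y t θ).PosSemidef :=
  Matrix.posSemidef_sum _ fun _ _ => hess_loss_posSemidef _ _ _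

theorem quadForm_fisher_le_exp_mul {x : ℕ → Param p} {y : ℕ → ℝ} {t : ℕ} {M : ℝ}
    (hx : ∀ s, 1 ≤ s → ‖x s‖ ≤ M) (θ θ' v : Param p) :
    quadForm (fisher x y t θ) v
      ≤ Real.exp (2 * M * ‖θ - θ'‖) * quadForm (fisher x y t θ') v := by
  unfold fisher
  rw [quadForm_sum, quadForm_sum, Finset.mul_sum]
  refine Finset.sum_le_sum fun s hs => (quadForm_hess_loss_le_exp_mul _ _ _ θ' v).trans ?_
  have h1 := quadForm_nonneg (hess_loss_posSemidef (x s) (y s) θ') v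
  have h2 := hx s (Finset.mem_Icc.1 hs).1
  rw [mul_assoc 2 M]
  gcongr

theorem fisher_self_concordant {x : ℕ → Param p} {y : ℕ → ℝ} {t : ℕ} {M K : ℝ}
    (hx : ∀ s, 1 ≤ s → ‖x s‖ ≤ M) (hK : 2 * M ≤ K) (θ h : Param p) :
    LoewnerLE (Real.exp (-(K * ‖h‖)) • fisher x y t θ) (fisher x y t (θ + h)) ∧
      LoewnerLE (fisher x y t (θ + h)) (Real.exp (K * ‖h‖) • fisher x y t θ) := by
  have hle : Real.exp (2 * M * ‖h‖) ≤ Real.exp (K * ‖h‖) := by gcongr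
  have hH := fun θ => (fisher_posSemidef x y t θ).isHermitian
  have hS := fun (c : ℝ) θ (hc : 0 ≤ c) => ((fisher_posSemidef x y t θ).smul hc).isHermitian
  constructor
  · refine loewnerLE_of_quadForm_le (hS _ _ (Real.exp_pos _).le) (hH _) fun v => ?_
    have h1 := quadForm_fisher_le_exp_mul (y := y) (t := t) hx θ (θ + h) v
    rw [sub_add_cancel_left, norm_neg] at h1
    have h2 := quadForm_nonneg (fisher_posSemidef x y t (θ + h)) v
    rw [quadForm_smul, Real.exp_neg, inv_mul_le_iff₀ (Real.exp_pos _)]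
    exact h1.trans (by gcongr)
  · refine loewnerLE_of_quadForm_le (hH _) (hS _ _ (Real.exp_pos _).le) fun v => ?_
    have h1 := quadForm_fisher_le_exp_mul (y := y) (t := t) hx (θ + h) θ v
    rw [add_sub_cancel_left] at h1
    have h2 := quadForm_nonneg (fisher_posSemidef x y t θ) v
    rw [quadForm_smul]
    exact h1.trans (by gcongr)

theorem loss_taylor (x : Param p) (y : ℝ) (θ₁ θ₂ : Param p) :
    ∃ θt ∈ segment ℝ θ₁ θ₂, loss x y θ₁ =
      loss x y θ₂ + inner ℝ (gradient (loss x y) θ₂) (θ₁ - θ₂)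
        + (1 / 2) * quadForm (hess (loss x y) θt) (θ₁ - θ₂) := by
  obtain ⟨τ, hτ, h⟩ := softplus_taylor (inner ℝ x θ₁) (inner ℝ x θ₂)
  refine ⟨θ₂ + τ • (θ₁ - θ₂), ?_, ?_⟩
  · rw [segment_symm, segment_eq_image']
    exact ⟨τ, hτ, rfl⟩
  · rw [gradient_loss, quadForm_hess_loss, inner_smul_left, inner_add_right, inner_smul_right,
      inner_sub_right]
    unfold loss
    rw [h]
    simp only [conj_trivial]
    ring

/-- The multiplicative bound on the weights is made linear in the distance. This needs a bounded
exponent: the diameter `2r` and `r‖x‖ ≤ M` cap it by `4M`. -/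
theorem hess_loss_le_of_mem_segment {x : Param p} {y M r : ℝ} (hr : max 1 r * ‖x‖ ≤ M)
    {θstar θ₁ θ₂ θt : Param p} (h₁ : θ₁ ∈ localSet θstar r) (h₂ : θ₂ ∈ localSet θstar r)
    (ht : θt ∈ segment ℝ θ₁ θ₂) :
    LoewnerLE (hess (loss x y) θ₁)
      ((1 + 2 * M * Real.exp (4 * M) * ‖θ₁ - θ₂‖) • hess (loss x y) θt) := by
  have hx0 := norm_nonneg x
  have hn := norm_nonneg (θ₁ - θ₂)
  have hxM : ‖x‖ ≤ M := (le_mul_of_one_le_left hx0 (le_max_left _ _)).trans hr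
  have hrM : r * ‖x‖ ≤ M := (mul_le_mul_of_nonneg_right (le_max_right _ _) hx0).trans hr
  have hM : 0 ≤ M := hx0.trans hxM
  have hseg : ‖θ₁ - θt‖ ≤ ‖θ₁ - θ₂‖ := by
    rw [← dist_eq_norm, ← dist_eq_norm]
    have := dist_add_dist_of_mem_segment ht
    linarith [dist_nonneg (x := θt) (y := θ₂)]
  have hdiam : ‖θ₁ - θ₂‖ ≤ 2 * r := by
    have e : θ₁ - θ₂ = (θ₁ - θstar) - (θ₂ - θstar) := by abel
    rw [e]
    have h1 : ‖θ₁ - θstar‖ ≤ r := h₁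
    have h2 : ‖θ₂ - θstar‖ ≤ r := h₂
    linarith [norm_sub_le (θ₁ - θstar) (θ₂ - θstar)]
  refine loewnerLE_of_quadForm_le (hess_loss_posSemidef _ _ _).isHermitian
    ((hess_loss_posSemidef _ _ _).smul (by positivity)).isHermitian fun v => ?_
  rw [quadForm_smul]
  refine (quadForm_hess_loss_le_exp_mul x y θ₁ θt v).trans ?_
  have h0 := quadForm_nonneg (hess_loss_posSemidef x y θt) v
  gcongr
  have h1 : 2 * (‖x‖ * ‖θ₁ - θt‖) ≤ 2 * M * ‖θ₁ - θ₂‖ := by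
    nlinarith [mul_le_mul hxM hseg (norm_nonneg _) hM]
  have h2 : 2 * (‖x‖ * ‖θ₁ - θt‖) ≤ 4 * M := by
    have : ‖x‖ * ‖θ₁ - θt‖ ≤ ‖x‖ * (2 * r) := by gcongr; exact hseg.trans hdiam
    nlinarith
  have h3 := exp_le_one_add_exp_mul (w := 2 * (‖x‖ * ‖θ₁ - θt‖)) (B := 4 * M) (by positivity) h2
  calc _ ≤ _ := h3
    _ ≤ 1 + Real.exp (4 * M) * (2 * M * ‖θ₁ - θ₂‖) := by gcongr
    _ = _ := by ring

/-- The good covariates alone bound the sum of Hessians from below, uniformly over `Θ_r`. -/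
theorem mul_norm_sq_le_quadForm_sum_hess {x : ℕ → Param p} {y : ℕ → ℝ} {θstar : Param p}
    {M m r : ℝ} {t : ℕ} (hx : ∀ s, 1 ≤ s → max 1 r * ‖x s‖ ≤ M)
    (hm : m ≤ lamMin (∑ s ∈ goodIdx x θstar M t, outer (x s))) {θbar : ℕ → Param p}
    (hθ : ∀ s ∈ Finset.Icc 1 t, θbar s ∈ localSet θstar r) (v : Param p) :
    Real.exp (-(4 * M)) / 4 * m * ‖v‖ ^ 2
      ≤ quadForm (∑ s ∈ Finset.Icc 1 t, hess (loss (x s) (y s)) (θbar s)) v := by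
  have h1 := mul_norm_sq_le_quadForm_of_le_lamMin
    (Matrix.posSemidef_sum _ fun s _ => outer_posSemidef (x s)) hm v
  rw [quadForm_sum] at h1
  rw [quadForm_sum]
  calc _ = Real.exp (-(4 * M)) / 4 * (m * ‖v‖ ^ 2) := by ring
    _ ≤ Real.exp (-(4 * M)) / 4 * ∑ s ∈ goodIdx x θstar M t, quadForm (outer (x s)) v := by
        gcongr
    _ = ∑ s ∈ goodIdx x θstar M t, Real.exp (-(4 * M)) / 4 * quadForm (outer (x s)) v :=
        Finset.mul_sum _ _ _
    _ ≤ ∑ s ∈ goodIdx x θstar M t, quadForm (hess (loss (x s) (y s)) (θbar s)) v := by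
        refine Finset.sum_le_sum fun s hs => ?_
        obtain ⟨hs1, hs2⟩ := Finset.mem_filter.1 hs
        rw [hess_loss, quadForm_smul]
        have h0 := quadForm_nonneg (outer_posSemidef (x s)) v
        gcongr
        -- One `M` comes from the index being good at `θstar`, the other from the displacement, at
        -- most `r‖x s‖`.
        have h3 : |(inner ℝ (x s) (θbar s) : ℝ)| ≤ 2 * M := by
          have h4 := abs_inner_sub_inner_le (x s) (θbar s) θstar
          have h5 : ‖θbar s - θstar‖ ≤ r := hθ s hs1
          have h6 : ‖x s‖ * ‖θbar s - θstar‖ ≤ M := by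
            refine le_trans ?_ (hx s (Finset.mem_Icc.1 hs1).1)
            rw [mul_comm]
            gcongr
            exact h5.trans (le_max_right _ _)
          have h7 := abs_sub_abs_le_abs_sub (inner ℝ (x s) (θbar s)) (inner ℝ (x s) θstar)
          linarith
        have := wt_ge_of_abs_le h3
        rwa [← mul_assoc, show (2 : ℝ) * 2 = 4 by norm_num] at this
    _ ≤ _ := Finset.sum_le_sum_of_subset_of_nonneg (Finset.filter_subset _ _)
        fun s _ _ => quadForm_nonneg (hess_loss_posSemidef _ _ _) v

end Loss

/-! ### Cylinder events and Ville's inequality on the binary tree of responses -/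

section Ville

variable {p : ℕ} {S : Type*} {x : ℕ → Param p} {θstar : Param p} {Y : ℕ → S → ℝ}

/-- The outcomes whose first `k` responses agree with `y`. -/
def cyl (Y : ℕ → S → ℝ) (y : ℕ → ℝ) (k : ℕ) : Set S := {ω | ∀ s ∈ Finset.Icc 1 k, Y s ω = y s}

/-- `M y t` depends on `y` only through `y 1, …, y t`. -/
def DependsOnPast {α : Type*} (M : (ℕ → ℝ) → ℕ → α) : Prop :=
  ∀ y y' t, (∀ s ∈ Finset.Icc 1 t, y s = y' s) → M y t = M y' t

theorem cyl_eq_iInter (y : ℕ → ℝ) (k : ℕ) :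
    cyl Y y k = ⋂ i ∈ Finset.range k, (fun t : ℕ => Y (t + 1)) i ⁻¹' {y (i + 1)} := by
  ext ω
  simp only [cyl, Finset.mem_Icc, Set.mem_ofPred_eq, Finset.mem_range, Set.mem_iInter,
    Set.mem_preimage, Set.mem_singleton_iff]
  refine ⟨fun h i hi => h (i + 1) ⟨by omega, by omega⟩, fun h s hs => ?_⟩
  obtain ⟨i, rfl⟩ : ∃ i, s = i + 1 := ⟨s - 1, by omega⟩
  exact h i (by omega)

variable [MeasurableSpace S] {P : Measure S}

theorem LogisticModel.measurableSet_cyl (hM : LogisticModel P x θstar Y) (y : ℕ → ℝ) (k : ℕ) :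
    MeasurableSet (cyl Y y k) := by
  rw [cyl_eq_iInter]
  exact Finset.measurableSet_biInter _ fun i _ =>
    hM.measurable (i + 1) (by omega) (measurableSet_singleton _)

theorem LogisticModel.measure_cyl (hM : LogisticModel P x θstar Y) (y : ℕ → ℝ) (k : ℕ) :
    P.real (cyl Y y k) = ∏ i ∈ Finset.range k, P.real {ω | Y (i + 1) ω = y (i + 1)} := by
  rw [cyl_eq_iInter, measureReal_def,
    hM.indep.measure_inter_preimage_eq_mul _ fun i _ => measurableSet_singleton _,
    ENNReal.toReal_prod]
  rfl

theorem LogisticModel.measure_cyl_update (hM : LogisticModel P x θstar Y) (y : ℕ → ℝ) (k : ℕ)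
    (v : ℝ) : P.real (cyl Y (Function.update y (k + 1) v) (k + 1))
      = P.real (cyl Y y k) * P.real {ω | Y (k + 1) ω = v} := by
  rw [hM.measure_cyl, hM.measure_cyl, Finset.prod_range_succ, Function.update_self]
  congr 1
  refine Finset.prod_congr rfl fun i hi => ?_
  rw [Function.update_of_ne (by have := Finset.mem_range.1 hi; omega)]

theorem LogisticModel.prob_one' (hM : LogisticModel P x θstar Y) {t : ℕ} (ht : 1 ≤ t) :
    P.real {ω | Y t ω = 1} = Real.sigmoid (inner ℝ (x t) θstar) := by
  rw [hM.prob_one t ht, deriv_softplus]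

theorem LogisticModel.prob_zero' (hM : LogisticModel P x θstar Y) {t : ℕ} (ht : 1 ≤ t) :
    P.real {ω | Y t ω = 0} = 1 - Real.sigmoid (inner ℝ (x t) θstar) := by
  rw [hM.prob_zero t ht, deriv_softplus]

variable [IsProbabilityMeasure P]

theorem LogisticModel.ae_binary (hM : LogisticModel P x θstar Y) {t : ℕ} (ht : 1 ≤ t) :
    ∀ᵐ ω ∂P, Y t ω = 1 ∨ Y t ω = 0 := by
  have m1 : MeasurableSet {ω | Y t ω = 1} := hM.measurable t ht (measurableSet_singleton _)
  have m0 : MeasurableSet {ω | Y t ω = 0} := hM.measurable t ht (measurableSet_singleton _)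
  have hd : Disjoint {ω | Y t ω = 1} {ω | Y t ω = 0} := by
    rw [Set.disjoint_left]
    intro ω h1 h0
    exact one_ne_zero (h1.symm.trans h0)
  have h := measureReal_union (μ := P) hd m0
  rw [hM.prob_one' ht, hM.prob_zero' ht, add_sub_cancel] at h
  have h' : P.real ({ω | Y t ω = 1} ∪ {ω | Y t ω = 0})ᶜ = 0 := by
    rw [probReal_compl_eq_one_sub (m1.union m0), h, sub_self]
  rw [ae_iff]
  rw [measureReal_eq_zero_iff] at h'
  exact measure_mono_null (fun ω hω => hω) h'

/-- Anything that depends on finitely many responses is null-measurable. -/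
theorem LogisticModel.nullMeasurableSet_path (hM : LogisticModel P x θstar Y)
    {Q : (ℕ → ℝ) → ℕ → Prop} (hQ : DependsOnPast Q) (n : ℕ) :
    NullMeasurableSet {ω | Q (path Y ω) n} P := by
  classical
  let ind : Finset ℕ → ℕ → ℝ := fun T s => if s ∈ T then 1 else 0
  -- Almost surely the first `n` responses form a binary string, coded by the set `T` of its ones.
  -- The event is thus a finite union of cylinders up to a null set, whatever the regularity of `Q`.
  let U : Set S := ⋃ T ∈ {T ∈ (Finset.Icc 1 n).powerset | Q (ind T) n}, cyl Y (ind T) n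
  have hU : MeasurableSet U :=
    Finset.measurableSet_biUnion _ fun T _ => hM.measurableSet_cyl (ind T) n
  refine hU.nullMeasurableSet.congr ?_
  have hb : ∀ᵐ ω ∂P, ∀ s ∈ Finset.Icc 1 n, Y s ω = 1 ∨ Y s ω = 0 :=
    (Filter.eventually_all_finset _).2 fun s hs => hM.ae_binary (Finset.mem_Icc.1 hs).1
  filter_upwards [hb] with ω hω
  have key : ω ∈ U ↔ Q (path Y ω) n := by
    simp only [U, Set.mem_iUnion, Finset.mem_filter, exists_prop]
    constructor
    · rintro ⟨T, ⟨-, hT⟩, hc⟩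
      rwa [hQ (path Y ω) (ind T) n hc]
    · intro h
      let T : Finset ℕ := {s ∈ Finset.Icc 1 n | Y s ω = 1}
      have hc : ω ∈ cyl Y (ind T) n := by
        intro s hs
        rcases hω s hs with h1 | h0
        · simp [ind, T, Finset.mem_filter.2, h1, Finset.mem_Icc.1 hs]
        · simp [ind, T, h0]
      refine ⟨T, ⟨Finset.mem_powerset.2 (Finset.filter_subset _ _), ?_⟩, hc⟩
      rwa [← hQ (path Y ω) (ind T) n hc]
  exact propext key

/-- A test supermartingale, as a function of the responses. -/
structure IsTestProcess (x : ℕ → Param p) (θstar : Param p) (M : (ℕ → ℝ) → ℕ → ℝ) : Prop where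
  nonneg : ∀ y t, 0 ≤ M y t
  adapted : DependsOnPast M
  step : ∀ y t,
    Real.sigmoid (inner ℝ (x (t + 1)) θstar) * M (Function.update y (t + 1) 1) (t + 1)
      + (1 - Real.sigmoid (inner ℝ (x (t + 1)) θstar)) * M (Function.update y (t + 1) 0) (t + 1)
      ≤ M y t

/-- Induction on the remaining horizon `m`, for all nodes of the tree at once. Either the level is
already reached at the node, or the cylinder splits into its two children and the supermartingale
step combines their bounds. Working with cylinders avoids conditional expectations. -/
theorem LogisticModel.ville_finite (hM : LogisticModel P x θstar Y)
    {M : (ℕ → ℝ) → ℕ → ℝ} (h : IsTestProcess x θstar M) {a : ℝ} (m : ℕ) :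
    ∀ k y, P.real (cyl Y y k ∩ {ω | ∃ s, k ≤ s ∧ s ≤ k + m ∧ a ≤ M (path Y ω) s}) * a
      ≤ P.real (cyl Y y k) * M y k := by
  have trivial_case : ∀ k y (F : Set S), a ≤ M y k →
      P.real (cyl Y y k ∩ F) * a ≤ P.real (cyl Y y k) * M y k := by
    intro k y F hle
    calc _ ≤ P.real (cyl Y y k ∩ F) * M y k := by gcongr
      _ ≤ _ := mul_le_mul_of_nonneg_right (measureReal_mono Set.inter_subset_left) (h.nonneg y k)
  have hcyl : ∀ {k y ω}, ω ∈ cyl Y y k → M (path Y ω) k = M y k := fun {k y ω} hω =>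
    h.adapted (path Y ω) y k hω
  induction m with
  | zero =>
    intro k y
    rcases le_or_gt a (M y k) with hle | hlt
    · exact trivial_case _ _ _ hle
    · have : cyl Y y k ∩ {ω | ∃ s, k ≤ s ∧ s ≤ k + 0 ∧ a ≤ M (path Y ω) s} = ∅ := by
        ext ω
        simp only [Set.mem_inter_iff, Set.mem_ofPred_eq, Set.mem_empty_iff_false, iff_false]
        rintro ⟨hω, s, h1, h2, h3⟩
        obtain rfl : s = k := by omega
        rw [hcyl hω] at h3
        linarith
      rw [this, measureReal_empty, zero_mul]
      exact mul_nonneg measureReal_nonneg (h.nonneg y k)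
  | succ m ih =>
    intro k y
    rcases le_or_gt a (M y k) with hle | hlt
    · exact trivial_case _ _ _ hle
    rcases le_or_gt a 0 with ha | ha
    · exact (mul_nonpos_of_nonneg_of_nonpos measureReal_nonneg ha).trans
        (mul_nonneg measureReal_nonneg (h.nonneg y k))
    set y1 := Function.update y (k + 1) 1
    set y0 := Function.update y (k + 1) 0
    set F : Set S := {ω | ∃ s, k + 1 ≤ s ∧ s ≤ k + 1 + m ∧ a ≤ M (path Y ω) s}
    have hext : ∀ ω v, ω ∈ cyl Y y k → Y (k + 1) ω = v →
        ω ∈ cyl Y (Function.update y (k + 1) v) (k + 1) := by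
      intro ω v hω hv s hs
      by_cases hsk : s = k + 1
      · subst hsk; rw [Function.update_self, hv]
      · rw [Function.update_of_ne hsk]
        have := Finset.mem_Icc.1 hs
        exact hω s (Finset.mem_Icc.2 ⟨this.1, by omega⟩)
    have hsub : P.real (cyl Y y k ∩ {ω | ∃ s, k ≤ s ∧ s ≤ k + (m + 1) ∧ a ≤ M (path Y ω) s})
        ≤ P.real ((cyl Y y1 (k + 1) ∩ F) ∪ (cyl Y y0 (k + 1) ∩ F)) := by
      rw [measureReal_def, measureReal_def]
      refine ENNReal.toReal_mono (measure_ne_top _ _) (measure_mono_ae ?_)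
      filter_upwards [hM.ae_binary (t := k + 1) (by omega)] with ω hω
      rintro ⟨hc, s, h1, h2, h3⟩
      have hsk : s ≠ k := by
        rintro rfl
        rw [hcyl hc] at h3
        linarith
      have hF : ω ∈ F := ⟨s, by omega, by omega, h3⟩
      rcases hω with h' | h'
      · exact Or.inl ⟨hext ω 1 hc h', hF⟩
      · exact Or.inr ⟨hext ω 0 hc h', hF⟩
    calc _ ≤ (P.real (cyl Y y1 (k + 1) ∩ F) + P.real (cyl Y y0 (k + 1) ∩ F)) * a := by
          gcongr
          exact hsub.trans (measureReal_union_le _ _)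
      _ ≤ P.real (cyl Y y1 (k + 1)) * M y1 (k + 1)
          + P.real (cyl Y y0 (k + 1)) * M y0 (k + 1) := by
          rw [add_mul]
          exact add_le_add (ih _ _) (ih _ _)
      _ = P.real (cyl Y y k) *
          (Real.sigmoid (inner ℝ (x (k + 1)) θstar) * M y1 (k + 1)
            + (1 - Real.sigmoid (inner ℝ (x (k + 1)) θstar)) * M y0 (k + 1)) := by
          rw [hM.measure_cyl_update, hM.measure_cyl_update, hM.prob_one' (by omega),
            hM.prob_zero' (by omega)]
          ring
      _ ≤ _ := mul_le_mul_of_nonneg_left (h.step y k) measureReal_nonneg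

/-- **Ville's inequality** for test supermartingales of the logistic model. -/
theorem LogisticModel.ville (hM : LogisticModel P x θstar Y)
    {M : (ℕ → ℝ) → ℕ → ℝ} (h : IsTestProcess x θstar M) {a : ℝ} (ha : 0 < a)
    (h1 : M 0 0 ≤ 1) : P.real {ω | ∃ t, a ≤ M (path Y ω) t} ≤ a⁻¹ := by
  have hfin : ∀ n, P {ω | ∃ s, s ≤ n ∧ a ≤ M (path Y ω) s} ≤ ENNReal.ofReal a⁻¹ := by
    intro n
    have := hM.ville_finite h (a := a) n 0 0
    have hc : cyl Y 0 0 = Set.univ := by ext; simp [cyl]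
    rw [hc, Set.univ_inter, probReal_univ, one_mul] at this
    simp only [zero_le, true_and, zero_add] at this
    rw [← ofReal_measureReal]
    refine ENNReal.ofReal_le_ofReal ?_
    rw [← one_div, le_div_iff₀ ha]
    exact this.trans h1
  have hU : {ω | ∃ t, a ≤ M (path Y ω) t} = ⋃ n, {ω | ∃ s, s ≤ n ∧ a ≤ M (path Y ω) s} := by
    ext ω
    simp only [Set.mem_ofPred_eq, Set.mem_iUnion]
    exact ⟨fun ⟨t, ht⟩ => ⟨t, t, le_rfl, ht⟩, fun ⟨_, t, _, ht⟩ => ⟨t, ht⟩⟩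
  have hmono : Monotone fun n : ℕ => {ω | ∃ s, s ≤ n ∧ a ≤ M (path Y ω) s} :=
    fun n m hnm ω ⟨s, hs, hM⟩ => ⟨s, hs.trans hnm, hM⟩
  rw [hU, measureReal_def, hmono.measure_iUnion]
  exact ENNReal.toReal_le_of_le_ofReal (by positivity) (iSup_le hfin)

end Ville

/-! ### Adaptedness, growth of the precision matrix, and the two test processes -/

section Algorithm

variable {p : ℕ} {x : ℕ → Param p} {θstar : Param p}

/-- The exponential of a sum of increments with conditional exponential moments at most one. -/
theorem isTestProcess_exp_sum {D : (ℕ → ℝ) → ℕ → ℝ}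
    (hD : ∀ y y' s, (∀ i ∈ Finset.Icc 1 (s + 1), y i = y' i) → D y s = D y' s)
    (hstep : ∀ y s,
      Real.sigmoid (inner ℝ (x (s + 1)) θstar) * Real.exp (D (Function.update y (s + 1) 1) s)
        + (1 - Real.sigmoid (inner ℝ (x (s + 1)) θstar))
          * Real.exp (D (Function.update y (s + 1) 0) s) ≤ 1) :
    IsTestProcess x θstar fun y t => Real.exp (∑ s ∈ Finset.range t, D y s) where
  nonneg y t := (Real.exp_pos _).le
  adapted y y' t h := by
    change Real.exp _ = Real.exp _
    congr 1
    refine Finset.sum_congr rfl fun s hs => hD y y' s fun i hi => h i ?_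
    simp only [Finset.mem_range, Finset.mem_Icc] at *
    omega
  step y t := by
    have hpast : ∀ v, ∑ s ∈ Finset.range t, D (Function.update y (t + 1) v) s
        = ∑ s ∈ Finset.range t, D y s := fun v => by
      refine Finset.sum_congr rfl fun s hs => hD _ _ s fun i hi => ?_
      rw [Function.update_of_ne]
      simp only [Finset.mem_range, Finset.mem_Icc] at *
      omega
    simp only [Finset.sum_range_succ, hpast, Real.exp_add]
    have := mul_le_mul_of_nonneg_left (hstep y t)
      (Real.exp_pos (∑ s ∈ Finset.range t, D y s)).le
    linarith

variable {θ₀ : Param p} {Om₀ : Mat p} {t₀ : ℕ}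

/-- The minimiser is chosen from a predicate depending only on the objective, so equal objectives
give equal choices. Existence and uniqueness are not needed. -/
theorem mapEst_dependsOnPast : DependsOnPast fun y t => mapEst x y θ₀ Om₀ t := by
  intro y y' t h
  have : mapObjective x y θ₀ Om₀ t = mapObjective x y' θ₀ Om₀ t := by
    ext θ
    unfold mapObjective
    congr 1
    exact Finset.sum_congr rfl fun s hs => by rw [h s hs]
  simp only [mapEst, this]

theorem fisher_eq_of_responses (y y' : ℕ → ℝ) (t : ℕ) (θ : Param p) :
    fisher x y t θ = fisher x y' t θ :=
  Finset.sum_congr rfl fun s _ => by rw [hess_loss, hess_loss]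

theorem state_dependsOnPast : DependsOnPast fun y t => state x y θ₀ Om₀ t₀ t := by
  intro y y' t
  induction t with
  | zero => intro _; rfl
  | succ t ih =>
    intro h
    have ih' := ih fun s hs => h s (by simp only [Finset.mem_Icc] at *; omega)
    have h1 : y (t + 1) = y' (t + 1) := h _ (by simp)
    have h2 := mapEst_dependsOnPast (x := x) (θ₀ := θ₀) (Om₀ := Om₀) y y' (t + 1) h
    simp only [state] at *
    rw [h2, fisher_eq_of_responses y y', h1, ih']

theorem iter_dependsOnPast : DependsOnPast fun y t => iter x y θ₀ Om₀ t₀ t := fun y y' t h =>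
  congrArg Prod.fst (state_dependsOnPast (x := x) (θ₀ := θ₀) (Om₀ := Om₀) (t₀ := t₀) y y' t h)

theorem prec_dependsOnPast : DependsOnPast fun y t => prec x y θ₀ Om₀ t₀ t := fun y y' t h =>
  congrArg Prod.snd (state_dependsOnPast (x := x) (θ₀ := θ₀) (Om₀ := Om₀) (t₀ := t₀) y y' t h)

theorem prec_succ {y : ℕ → ℝ} {t : ℕ} (ht : t₀ ≤ t) :
    prec x y θ₀ Om₀ t₀ (t + 1) = prec x y θ₀ Om₀ t₀ t
      + wt (inner ℝ (x (t + 1)) (iter x y θ₀ Om₀ t₀ t)) • outer (x (t + 1)) := by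
  have : ¬ t + 1 ≤ t₀ := by omega
  rw [← hess_loss _ (y (t + 1))]
  simp only [prec, iter, state, if_neg this, onlineStep]

theorem iter_switch (ht₀ : 1 ≤ t₀) (y : ℕ → ℝ) :
    iter x y θ₀ Om₀ t₀ t₀ = mapEst x y θ₀ Om₀ t₀ := by
  obtain ⟨n, rfl⟩ : ∃ n, t₀ = n + 1 := ⟨t₀ - 1, by omega⟩
  simp [iter, state]

theorem prec_switch (ht₀ : 1 ≤ t₀) (y : ℕ → ℝ) :
    prec x y θ₀ Om₀ t₀ t₀ = Om₀ + fisher x y t₀ (iter x y θ₀ Om₀ t₀ t₀) := by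
  rw [iter_switch ht₀]
  obtain ⟨n, rfl⟩ : ∃ n, t₀ = n + 1 := ⟨t₀ - 1, by omega⟩
  simp [prec, state]

theorem prec_posDef (hOm : Om₀.PosDef) (ht₀ : 1 ≤ t₀) (y : ℕ → ℝ) {t : ℕ} (ht : t₀ ≤ t) :
    (prec x y θ₀ Om₀ t₀ t).PosDef := by
  induction t, ht using Nat.le_induction with
  | base => rw [prec_switch ht₀]; exact hOm.add_posSemidef (fisher_posSemidef _ _ _ _)
  | succ t ht ih =>
    rw [prec_succ ht]
    exact ih.add_posSemidef ((outer_posSemidef _).smul (wt_pos _).le)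

/-- The curvature collected at time `t₀` suffices: later updates only add positive semidefinite
terms, so later iterates may leave `Θ_r`. -/
theorem prec_lower_bound (hOm : Om₀.PosDef) (ht₀ : 1 ≤ t₀) {M m r : ℝ}
    (hx : ∀ s, 1 ≤ s → max 1 r * ‖x s‖ ≤ M)
    (hm : m ≤ lamMin (∑ s ∈ goodIdx x θstar M t₀, outer (x s))) {y : ℕ → ℝ}
    (hθ : iter x y θ₀ Om₀ t₀ t₀ ∈ localSet θstar r) {t : ℕ} (ht : t₀ ≤ t) (v : Param p) :
    Real.exp (-(4 * M)) / 4 * m * ‖v‖ ^ 2 ≤ quadForm (prec x y θ₀ Om₀ t₀ t) v := by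
  induction t, ht using Nat.le_induction with
  | base =>
    rw [prec_switch ht₀, quadForm_add]
    have h1 := mul_norm_sq_le_quadForm_sum_hess (y := y) hx hm
      (θbar := fun _ => iter x y θ₀ Om₀ t₀ t₀) (fun _ _ => hθ) v
    have h2 := quadForm_nonneg hOm.posSemidef v
    unfold fisher
    linarith
  | succ t ht ih =>
    rw [prec_succ ht, quadForm_add]
    have := quadForm_nonneg ((outer_posSemidef (x (t + 1))).smul
      (wt_pos (inner ℝ (x (t + 1)) (iter x y θ₀ Om₀ t₀ t))).le) v
    linarith

theorem quadForm_prec_le {M : ℝ} (hx : ∀ s, 1 ≤ s → ‖x s‖ ≤ M) {y : ℕ → ℝ} {t : ℕ}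
    (ht : t₀ ≤ t) (v : Param p) :
    quadForm (prec x y θ₀ Om₀ t₀ t) v
      ≤ quadForm (prec x y θ₀ Om₀ t₀ t₀) v + (t - t₀) * (M ^ 2 * ‖v‖ ^ 2) := by
  induction t, ht using Nat.le_induction with
  | base => simp
  | succ t ht ih =>
    rw [prec_succ ht, quadForm_add, quadForm_smul]
    set w := wt (inner ℝ (x (t + 1)) (iter x y θ₀ Om₀ t₀ t))
    have hw : w ≤ 1 := by linarith [wt_le_quarter (inner ℝ (x (t + 1)) (iter x y θ₀ Om₀ t₀ t))]
    have h1 : w * quadForm (outer (x (t + 1))) v ≤ M ^ 2 * ‖v‖ ^ 2 := by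
      refine (mul_le_of_le_one_left (quadForm_nonneg (outer_posSemidef _) v) hw).trans ?_
      refine (quadForm_outer_le _ _).trans ?_
      gcongr
      exact hx _ (by omega)
    push_cast
    linarith

/-- The weighted leverage `b''(⟨x_s, θ_{s-1}⟩) ⟨x_s, Ω_s⁻¹ x_s⟩` sums to at most a log-determinant
ratio. -/
theorem sum_leverage_le_log_det (hOm : Om₀.PosDef) (ht₀ : 1 ≤ t₀) (y : ℕ → ℝ) {t : ℕ}
    (ht : t₀ ≤ t) :
    ∑ s ∈ Finset.Ico t₀ t, wt (inner ℝ (x (s + 1)) (iter x y θ₀ Om₀ t₀ s))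
        * quadForm (prec x y θ₀ Om₀ t₀ (s + 1))⁻¹ (x (s + 1))
      ≤ Real.log (prec x y θ₀ Om₀ t₀ t).det - Real.log (prec x y θ₀ Om₀ t₀ t₀).det := by
  induction t, ht using Nat.le_induction with
  | base => simp
  | succ t ht ih =>
    rw [Finset.sum_Ico_succ_top ht]
    have := mul_quadForm_inv_le_log_det (prec_posDef (x := x) (θ₀ := θ₀) hOm ht₀ y ht)
      (wt_pos (inner ℝ (x (t + 1)) (iter x y θ₀ Om₀ t₀ t))).le (x (t + 1))
    rw [← prec_succ ht] at this
    linarith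

/-- Comparing with `Ω_{t₀}` itself, rather than with the identity, makes the bound free of the
prior: `Ω_t ⪯ (1 + B) t Ω_{t₀}`. -/
theorem log_det_prec_sub_le (hOm : Om₀.PosDef) (ht₀ : 1 ≤ t₀) {M m : ℝ} (hm : 0 < m)
    (hx : ∀ s, 1 ≤ s → ‖x s‖ ≤ M) {y : ℕ → ℝ}
    (hlow : ∀ v, m * ‖v‖ ^ 2 ≤ quadForm (prec x y θ₀ Om₀ t₀ t₀) v) {t : ℕ} (ht : t₀ < t) :
    Real.log (prec x y θ₀ Om₀ t₀ t).det - Real.log (prec x y θ₀ Om₀ t₀ t₀).det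
      ≤ (1 + 2 * (M ^ 2 / m)) * (p * Real.log t) := by
  have hA := prec_posDef (x := x) (θ₀ := θ₀) hOm ht₀ y le_rfl
  have hB := prec_posDef (x := x) (θ₀ := θ₀) hOm ht₀ y ht.le
  set B := M ^ 2 / m with hBdef
  have hB0 : 0 ≤ B := by positivity
  have ht2 : (2 : ℝ) ≤ t := by exact_mod_cast (by omega : 2 ≤ t)
  have hdet : (prec x y θ₀ Om₀ t₀ t).det ≤ ((1 + B) * t) ^ p * (prec x y θ₀ Om₀ t₀ t₀).det := by
    refine det_le_pow_mul_det hA hB.posSemidef fun v => ?_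
    refine (quadForm_prec_le hx ht.le v).trans ?_
    have h1 : M ^ 2 * ‖v‖ ^ 2 = B * (m * ‖v‖ ^ 2) := by
      rw [hBdef]; field_simp
    have h0 := quadForm_nonneg hA.posSemidef v
    have h2 : ((t : ℝ) - t₀) * (M ^ 2 * ‖v‖ ^ 2)
        ≤ t * (B * quadForm (prec x y θ₀ Om₀ t₀ t₀) v) := by
      rw [h1]
      have h3 : B * (m * ‖v‖ ^ 2) ≤ B * quadForm (prec x y θ₀ Om₀ t₀ t₀) v := by
        gcongr
        exact hlow v
      have h4 : (0 : ℝ) ≤ t₀ := Nat.cast_nonneg _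
      have h5 : (t₀ : ℝ) ≤ t := by exact_mod_cast ht.le
      exact mul_le_mul (by linarith) h3 (by positivity) (by linarith)
    nlinarith
  have hlog := Real.log_le_log hB.det_pos hdet
  rw [Real.log_mul (by positivity) hA.det_pos.ne', Real.log_pow,
    Real.log_mul (by positivity) (by positivity)] at hlog
  have h6 : Real.log (1 + B) ≤ B := by
    have := Real.log_le_sub_one_of_pos (by positivity : 0 < 1 + B)
    linarith
  -- Since `t ≥ 2`, the constant `log (1 + B)` can be absorbed into a multiple of `log t`.
  have h7 : 1 / 2 ≤ Real.log t :=
    (by linarith [Real.log_two_gt_d9] : 1 / 2 ≤ Real.log 2).trans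
      (Real.log_le_log (by norm_num) ht2)
  have h8 : Real.log (1 + B) + Real.log t ≤ (1 + 2 * B) * Real.log t := by nlinarith
  have h9 : (p : ℝ) * (Real.log (1 + B) + Real.log t) ≤ p * ((1 + 2 * B) * Real.log t) := by
    gcongr
  linarith

/-- Log-likelihood ratio of the one-step-ahead predictions against the truth. -/
theorem isTestProcess_likelihood_ratio :
    IsTestProcess x θstar fun y t => Real.exp (∑ s ∈ Finset.range t,
      if t₀ ≤ s then loss (x (s + 1)) (y (s + 1)) θstar
        - loss (x (s + 1)) (y (s + 1)) (iter x y θ₀ Om₀ t₀ s) else 0) := by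
  refine isTestProcess_exp_sum (fun y y' s h => ?_) fun y s => ?_
  · have hi : iter x y θ₀ Om₀ t₀ s = iter x y' θ₀ Om₀ t₀ s :=
      iter_dependsOnPast y y' s fun i hi => h i (by simp only [Finset.mem_Icc] at *; omega)
    rw [h (s + 1) (by simp), hi]
  · have hit : ∀ v, iter x (Function.update y (s + 1) v) θ₀ Om₀ t₀ s = iter x y θ₀ Om₀ t₀ s :=
      fun v => iter_dependsOnPast _ _ s fun i hi => by
        rw [Function.update_of_ne]
        simp only [Finset.mem_Icc] at hi
        omega
    split_ifs with hs
    · simp only [hit, Function.update_self, loss]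
      exact (likelihood_ratio_mean _ _).le
    · simp

/-- Before it leaves `Θ_r`, the algorithm's squared Newton decrements are dominated by the weighted
leverages, in the sense of a test supermartingale. -/
theorem isTestProcess_decrement {M B r : ℝ} (hx : ∀ s, 1 ≤ s → max 1 r * ‖x s‖ ≤ M)
    (hB : ∀ y, iter x y θ₀ Om₀ t₀ t₀ ∈ localSet θstar r → ∀ s, t₀ ≤ s →
      0 ≤ quadForm (prec x y θ₀ Om₀ t₀ (s + 1))⁻¹ (x (s + 1)) ∧
        quadForm (prec x y θ₀ Om₀ t₀ (s + 1))⁻¹ (x (s + 1)) ≤ B) :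
    IsTestProcess x θstar fun y t => Real.exp (∑ s ∈ Finset.range t,
      open Classical in
      if t₀ ≤ s ∧ ∀ k ∈ Finset.Icc t₀ s, iter x y θ₀ Om₀ t₀ k ∈ localSet θstar r then
        (Real.sigmoid (inner ℝ (x (s + 1)) (iter x y θ₀ Om₀ t₀ s)) - y (s + 1)) ^ 2
            * quadForm (prec x y θ₀ Om₀ t₀ (s + 1))⁻¹ (x (s + 1))
          - Real.exp (B + M) * (wt (inner ℝ (x (s + 1)) (iter x y θ₀ Om₀ t₀ s))
            * quadForm (prec x y θ₀ Om₀ t₀ (s + 1))⁻¹ (x (s + 1)))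
      else 0) := by
  classical
  have hiter : ∀ {y y' : ℕ → ℝ} {s k : ℕ}, (∀ i ∈ Finset.Icc 1 s, y i = y' i) → k ≤ s →
      iter x y θ₀ Om₀ t₀ k = iter x y' θ₀ Om₀ t₀ k := fun h hk =>
    iter_dependsOnPast _ _ _ fun i hi => h i (by simp only [Finset.mem_Icc] at *; omega)
  refine isTestProcess_exp_sum (fun y y' s h => ?_) fun y s => ?_
  · have h' : ∀ i ∈ Finset.Icc 1 s, y i = y' i := fun i hi => h i (by
      simp only [Finset.mem_Icc] at *; omega)
    have hact : (∀ k ∈ Finset.Icc t₀ s, iter x y θ₀ Om₀ t₀ k ∈ localSet θstar r)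
        ↔ ∀ k ∈ Finset.Icc t₀ s, iter x y' θ₀ Om₀ t₀ k ∈ localSet θstar r :=
      forall₂_congr fun k hk => by rw [hiter h' (Finset.mem_Icc.1 hk).2]
    have hprec := prec_dependsOnPast (x := x) (θ₀ := θ₀) (Om₀ := Om₀) (t₀ := t₀) y y' (s + 1) h
    simp only at hprec
    rw [h (s + 1) (by simp), hiter h' le_rfl, hprec]
    simp only [hact]
  · have hag : ∀ v, ∀ i ∈ Finset.Icc 1 s, Function.update y (s + 1) v i = y i := fun v i hi => by
      rw [Function.update_of_ne]
      simp only [Finset.mem_Icc] at hi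
      omega
    by_cases hs : t₀ ≤ s ∧ ∀ k ∈ Finset.Icc t₀ s, iter x y θ₀ Om₀ t₀ k ∈ localSet θstar r
    · have hs' : ∀ v, t₀ ≤ s ∧ ∀ k ∈ Finset.Icc t₀ s,
          iter x (Function.update y (s + 1) v) θ₀ Om₀ t₀ k ∈ localSet θstar r := fun v =>
        ⟨hs.1, fun k hk => by rw [hiter (hag v) (Finset.mem_Icc.1 hk).2]; exact hs.2 k hk⟩
      -- Predictability of the precision: the update at time `s + 1` uses a Hessian, which is free
      -- of the response `y (s + 1)`.
      have hprec : ∀ v, prec x (Function.update y (s + 1) v) θ₀ Om₀ t₀ (s + 1)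
          = prec x y θ₀ Om₀ t₀ (s + 1) := fun v => by
        have := prec_dependsOnPast (x := x) (θ₀ := θ₀) (Om₀ := Om₀) (t₀ := t₀) _ y s (hag v)
        simp only at this
        rw [prec_succ hs.1, prec_succ hs.1, this, hiter (hag v) le_rfl]
      simp only [if_pos (hs' _), Function.update_self, hprec, hiter (hag _) le_rfl, Real.exp_sub]
      obtain ⟨hz0, hzB⟩ := hB y (hs.2 t₀ (Finset.mem_Icc.2 ⟨le_rfl, hs.1⟩)) s hs.1
      have hd : |(inner ℝ (x (s + 1)) (iter x y θ₀ Om₀ t₀ s) : ℝ) - inner ℝ (x (s + 1)) θstar|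
          ≤ M := by
        have h5 : ‖iter x y θ₀ Om₀ t₀ s - θstar‖ ≤ r := hs.2 s (Finset.mem_Icc.2 ⟨hs.1, le_rfl⟩)
        refine (abs_inner_sub_inner_le _ _ _).trans (le_trans ?_ (hx (s + 1) (by omega)))
        rw [mul_comm]
        gcongr
        exact h5.trans (le_max_right _ _)
      have := squared_residual_mgf_le hd hz0 hzB
      rw [← mul_div_assoc, ← mul_div_assoc, ← add_div, div_le_one (Real.exp_pos _)]
      exact this
    · have hs' : ∀ v, ¬ (t₀ ≤ s ∧ ∀ k ∈ Finset.Icc t₀ s,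
          iter x (Function.update y (s + 1) v) θ₀ Om₀ t₀ k ∈ localSet θstar r) := fun v h =>
        hs ⟨h.1, fun k hk => by
          rw [← hiter (hag v) (Finset.mem_Icc.1 hk).2]; exact h.2 k hk⟩
      simp only [if_neg (hs' _), Real.exp_zero]
      linarith

/-- The strict bound on `k` is enough: the summand at the stopping time uses the preceding iterate.
Membership at `t₀` itself comes from the MAP event instead. -/
theorem stopAt_spec {y : ℕ → ℝ} {r : ℝ} {t : ℕ} (ht : t₀ < t) :
    t₀ < stopAt x y θ₀ Om₀ t₀ θstar r t ∧
      ∀ k, t₀ < k → k < stopAt x y θ₀ Om₀ t₀ θstar r t →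
        iter x y θ₀ Om₀ t₀ k ∈ localSet θstar r := by
  set e := exitTime x y θ₀ Om₀ t₀ θstar r with he
  have hne : min (t : ℕ∞) e ≠ ⊤ := ne_top_of_le_ne_top (ENat.natCast_ne_top t) (min_le_left _ _)
  have hT : ((stopAt x y θ₀ Om₀ t₀ θstar r t : ℕ) : ℕ∞) = min (t : ℕ∞) e := ENat.natCast_toNat hne
  constructor
  · have h1 : ((t₀ + 1 : ℕ) : ℕ∞) ≤ min (t : ℕ∞) e := by
      refine le_min (by exact_mod_cast ht) (le_sInf ?_)
      rintro n ⟨k, rfl, hk, -⟩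
      exact_mod_cast hk
    rw [← hT] at h1
    exact_mod_cast h1
  · intro k hk hkT
    by_contra hnot
    have h1 : e ≤ (k : ℕ∞) := sInf_le ⟨k, rfl, hk, hnot⟩
    have h2 : ((stopAt x y θ₀ Om₀ t₀ θstar r t : ℕ) : ℕ∞) ≤ k := hT ▸ (min_le_right _ _).trans h1
    have : stopAt x y θ₀ Om₀ t₀ θstar r t ≤ k := by exact_mod_cast h2
    omega

theorem sum_Icc_succ_eq_sum_Ico {β : Type*} [AddCommMonoid β] (f : ℕ → β) (a b : ℕ) :
    ∑ s ∈ Finset.Icc (a + 1) b, f s = ∑ s ∈ Finset.Ico a b, f (s + 1) := by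
  rw [Finset.sum_Ico_add' f a b 1]
  rfl

theorem sum_range_ite_eq_sum_Ico (f : ℕ → ℝ) (a b : ℕ) :
    ∑ s ∈ Finset.range b, (if a ≤ s then f s else 0) = ∑ s ∈ Finset.Ico a b, f s := by
  rw [← Finset.sum_filter]
  congr 1
  ext s
  simp [and_comm]

theorem quadForm_inv_prec_grad (y : ℕ → ℝ) (s : ℕ) :
    quadForm (prec x y θ₀ Om₀ t₀ (s + 1))⁻¹ (grad x y θ₀ Om₀ t₀ (s + 1))
      = (Real.sigmoid (inner ℝ (x (s + 1)) (iter x y θ₀ Om₀ t₀ s)) - y (s + 1)) ^ 2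
        * quadForm (prec x y θ₀ Om₀ t₀ (s + 1))⁻¹ (x (s + 1)) := by
  rw [grad, gradient_loss, quadForm_smul_vec, Nat.add_sub_cancel]

end Algorithm

/-! ### From avoided exceptional events to the stated bounds -/

section Conclusions

variable {p : ℕ} {x : ℕ → Param p} {θstar θ₀ : Param p} {Om₀ : Mat p} {t₀ : ℕ} {y : ℕ → ℝ}

theorem sum_loss_sub_le_of_likelihood_ratio {a : ℝ}
    (h : ¬ ∃ t, Real.exp a ≤ Real.exp (∑ s ∈ Finset.range t,
      if t₀ ≤ s then loss (x (s + 1)) (y (s + 1)) θstar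
        - loss (x (s + 1)) (y (s + 1)) (iter x y θ₀ Om₀ t₀ s) else 0)) (t : ℕ) :
    ∑ s ∈ Finset.Icc (t₀ + 1) t,
      (loss (x s) (y s) θstar - loss (x s) (y s) (iter x y θ₀ Om₀ t₀ (s - 1))) ≤ a := by
  push Not at h
  have := h t
  rw [Real.exp_lt_exp, sum_range_ite_eq_sum_Ico] at this
  rw [sum_Icc_succ_eq_sum_Ico]
  exact this.le

theorem leverage_bounds (hOm : Om₀.PosDef) (ht₀ : 1 ≤ t₀) {M m r : ℝ} (hm : 0 < m)
    (hx : ∀ s, 1 ≤ s → max 1 r * ‖x s‖ ≤ M)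
    (hlam : m ≤ lamMin (∑ s ∈ goodIdx x θstar M t₀, outer (x s)))
    (hθ : iter x y θ₀ Om₀ t₀ t₀ ∈ localSet θstar r) {s : ℕ} (hs : t₀ ≤ s) :
    0 ≤ quadForm (prec x y θ₀ Om₀ t₀ (s + 1))⁻¹ (x (s + 1)) ∧
      quadForm (prec x y θ₀ Om₀ t₀ (s + 1))⁻¹ (x (s + 1))
        ≤ M ^ 2 / (Real.exp (-(4 * M)) / 4 * m) := by
  have hA := prec_posDef (x := x) (θ₀ := θ₀) hOm ht₀ y (hs.trans s.le_succ)
  refine ⟨quadForm_nonneg hA.inv.posSemidef _, ?_⟩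
  refine (quadForm_inv_le hA (by positivity)
    (prec_lower_bound hOm ht₀ hx hlam hθ (hs.trans s.le_succ)) _).trans ?_
  gcongr
  exact (le_mul_of_one_le_left (norm_nonneg _) (le_max_left _ _)).trans (hx _ (by omega))

/-- Up to the stopping time the indicator in the test process is always on. Evaluating the process
there bounds the decrements by `a` plus `C` times the weighted leverages, which the log-determinant
estimate controls. -/
theorem sum_decrement_le {M m r a C : ℝ} (hOm : Om₀.PosDef) (ht₀ : 1 ≤ t₀) (hm : 0 < m)
    (hC : 0 ≤ C) (hx : ∀ s, 1 ≤ s → ‖x s‖ ≤ M)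
    (hlow : ∀ v, m * ‖v‖ ^ 2 ≤ quadForm (prec x y θ₀ Om₀ t₀ t₀) v)
    (hθ : iter x y θ₀ Om₀ t₀ t₀ ∈ localSet θstar r)
    (h : ¬ ∃ t, Real.exp a ≤ Real.exp (∑ s ∈ Finset.range t,
      open Classical in
      if t₀ ≤ s ∧ ∀ k ∈ Finset.Icc t₀ s, iter x y θ₀ Om₀ t₀ k ∈ localSet θstar r then
        (Real.sigmoid (inner ℝ (x (s + 1)) (iter x y θ₀ Om₀ t₀ s)) - y (s + 1)) ^ 2
            * quadForm (prec x y θ₀ Om₀ t₀ (s + 1))⁻¹ (x (s + 1))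
          - C * (wt (inner ℝ (x (s + 1)) (iter x y θ₀ Om₀ t₀ s))
            * quadForm (prec x y θ₀ Om₀ t₀ (s + 1))⁻¹ (x (s + 1)))
      else 0)) {t : ℕ} (ht : t₀ < t) :
    ∑ s ∈ Finset.Icc (t₀ + 1) (stopAt x y θ₀ Om₀ t₀ θstar r t),
        quadForm (prec x y θ₀ Om₀ t₀ s)⁻¹ (grad x y θ₀ Om₀ t₀ s)
      ≤ C * (1 + 2 * (M ^ 2 / m)) * (p * Real.log (stopAt x y θ₀ Om₀ t₀ θstar r t)) + a := by
  classical
  push Not at h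
  obtain ⟨hT, hin⟩ := stopAt_spec (x := x) (y := y) (θ₀ := θ₀) (Om₀ := Om₀) (θstar := θstar)
    (r := r) ht
  set T := stopAt x y θ₀ Om₀ t₀ θstar r t
  have h1 := h T
  rw [Real.exp_lt_exp] at h1
  have hact : ∀ s ∈ Finset.range T, (t₀ ≤ s ∧ ∀ k ∈ Finset.Icc t₀ s,
      iter x y θ₀ Om₀ t₀ k ∈ localSet θstar r) ↔ t₀ ≤ s := by
    intro s hs
    refine ⟨fun h => h.1, fun h => ⟨h, fun k hk => ?_⟩⟩
    obtain ⟨hk1, hk2⟩ := Finset.mem_Icc.1 hk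
    rcases hk1.eq_or_lt with rfl | hlt
    · exact hθ
    · exact hin k hlt (hk2.trans_lt (Finset.mem_range.1 hs))
  rw [Finset.sum_congr rfl fun s hs => if_congr (hact s hs) rfl rfl,
    sum_range_ite_eq_sum_Ico, Finset.sum_sub_distrib, ← Finset.mul_sum] at h1
  rw [sum_Icc_succ_eq_sum_Ico]
  simp only [quadForm_inv_prec_grad]
  have h2 := (sum_leverage_le_log_det (x := x) (θ₀ := θ₀) hOm ht₀ y hT.le).trans
    (log_det_prec_sub_le hOm ht₀ hm hx hlow hT)
  have h3 := mul_le_mul_of_nonneg_left h2 hC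
  linarith

variable {S : Type*} [MeasurableSpace S] {P : Measure S} [IsProbabilityMeasure P]
  {Y : ℕ → S → ℝ}

theorem LogisticModel.measureReal_mapEst_notMem_le (hM : LogisticModel P x θstar Y) {r a : ℝ}
    (h : 1 - a ≤ P.real {ω | mapEst x (path Y ω) θ₀ Om₀ t₀ ∈ localSet θstar r}) :
    P.real {ω | mapEst x (path Y ω) θ₀ Om₀ t₀ ∉ localSet θstar r} ≤ a := by
  have hnull : NullMeasurableSet {ω | mapEst x (path Y ω) θ₀ Om₀ t₀ ∈ localSet θstar r} P :=
    hM.nullMeasurableSet_path (Q := fun y t => mapEst x y θ₀ Om₀ t ∈ localSet θstar r)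
      (fun y y' t hyy => by
        have := mapEst_dependsOnPast (x := x) (θ₀ := θ₀) (Om₀ := Om₀) y y' t hyy
        simp only at this
        simp only [this]) t₀
  have := prob_compl_eq_one_sub₀ hnull
  have h2 : P.real {ω | mapEst x (path Y ω) θ₀ Om₀ t₀ ∈ localSet θstar r}ᶜ
      = 1 - P.real {ω | mapEst x (path Y ω) θ₀ Om₀ t₀ ∈ localSet θstar r} := by
    rw [measureReal_def, this, ENNReal.toReal_sub_of_le prob_le_one ENNReal.one_ne_top]
    rfl
  change P.real {ω | mapEst x (path Y ω) θ₀ Om₀ t₀ ∈ localSet θstar r}ᶜ ≤ a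
  linarith

/-- The bad events need not be measurable: the complement of a measurable hull of their union does
the job. -/
theorem exists_measurable_event_avoiding {A B C : Set S} {a : ℝ}
    (hA : P.real A ≤ a) (hB : P.real B ≤ a) (hC : P.real C ≤ a) :
    ∃ E : Set S, MeasurableSet E ∧ 1 - 3 * a ≤ P.real E ∧
      ∀ ω ∈ E, ω ∉ A ∧ ω ∉ B ∧ ω ∉ C := by
  refine ⟨(toMeasurable P (A ∪ B ∪ C))ᶜ, (measurableSet_toMeasurable _ _).compl, ?_,
    fun ω hω => ?_⟩
  · rw [probReal_compl_eq_one_sub (measurableSet_toMeasurable _ _), measureReal_def,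
      measure_toMeasurable]
    have h1 := measureReal_union_le (μ := P) (A ∪ B) C
    have h2 := measureReal_union_le (μ := P) A B
    rw [measureReal_def] at h1
    linarith
  · have h : ω ∉ A ∪ B ∪ C := fun h => hω (subset_toMeasurable _ _ h)
    simp only [Set.mem_union, not_or] at h
    exact ⟨h.1.1, h.1.2, h.2⟩

end Conclusions

end OnlineLogit

/-! ### Choice of the constant and assembly -/

open OnlineLogit in
theorem corollary3p4 (Kmin Kmax : ℝ) (hKmin : 0 < Kmin) (hKmax : 0 < Kmax) :
    ∃ K : ℝ, 0 < K ∧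
      ∀ (p : ℕ) (_ : 1 ≤ p) (xx r : ℝ) (_ : 0 < xx) (_ : 0 < r)
        {S : Type*} [MeasurableSpace S] (P : Measure S) [IsProbabilityMeasure P]
        (x : ℕ → Param p) (θstar : Param p) (Y : ℕ → S → ℝ) (θ₀ : Param p) (Om₀ : Mat p)
        (t₀ : ℕ),
        LogisticModel P x θstar Y →
        Om₀.PosDef →
        CondEx P x θstar Y θ₀ Om₀ xx r Kmin Kmax →
        1 ≤ t₀ → Kmax * (p + xx) ≤ t₀ →
        ∃ E : Set S, MeasurableSet E ∧ 1 - 3 * Real.exp (-xx) ≤ P.real E ∧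
          ∀ ω ∈ E,
            (∀ t : ℕ, t₀ < t →
              (∀ θbar : ℕ → Param p, (∀ s ∈ Finset.Icc 1 t, θbar s ∈ localSet θstar r) →
                K⁻¹ * t ≤ lamMin (∑ s ∈ Finset.Icc 1 t, hess (loss (x s) (Y s ω)) (θbar s))) ∧
              ∑ s ∈ Finset.Icc (t₀ + 1) t,
                (loss (x s) (Y s ω) θstar - loss (x s) (Y s ω) (iter x (path Y ω) θ₀ Om₀ t₀ (s - 1)))
                  ≤ K * xx ∧
              ∑ s ∈ Finset.Icc (t₀ + 1) (stopAt x (path Y ω) θ₀ Om₀ t₀ θstar r t),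
                quadForm (prec x (path Y ω) θ₀ Om₀ t₀ s)⁻¹ (grad x (path Y ω) θ₀ Om₀ t₀ s)
                  ≤ K * (p * Real.log (stopAt x (path Y ω) θ₀ Om₀ t₀ θstar r t) + xx)) ∧
            (∀ t : ℕ, 1 ≤ t →
              (∀ θ ∈ localSet θstar r, opNorm (hess (loss (x t) (Y t ω)) θ) ≤ K) ∧
              (∀ θ ∈ localSet θstar r, ∀ θ' ∈ localSet θstar r,
                opNorm (hess (loss (x t) (Y t ω)) θ - hess (loss (x t) (Y t ω)) θ')
                  ≤ K * ‖θ - θ'‖) ∧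
              (∀ θ ∈ localSet θstar r, ∀ h : Param p, θ + h ∈ localSet θstar r →
                LoewnerLE (Real.exp (-(K * ‖h‖)) • fisher x (path Y ω) t θ) (fisher x (path Y ω) t (θ + h)) ∧
                LoewnerLE (fisher x (path Y ω) t (θ + h)) (Real.exp (K * ‖h‖) • fisher x (path Y ω) t θ)) ∧
              (∀ θ₁ ∈ localSet θstar r, ∀ θ₂ ∈ localSet θstar r,
                ∃ θt ∈ localSet θstar r, θt ∈ segment ℝ θ₁ θ₂ ∧
                  LoewnerLE (hess (loss (x t) (Y t ω)) θ₁)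
                    ((1 + K * ‖θ₁ - θ₂‖) • hess (loss (x t) (Y t ω)) θt) ∧
                  loss (x t) (Y t ω) θ₁ =
                    loss (x t) (Y t ω) θ₂ + inner ℝ (gradient (loss (x t) (Y t ω)) θ₂) (θ₁ - θ₂)
                      + (1 / 2) * quadForm (hess (loss (x t) (Y t ω)) θt) (θ₁ - θ₂))) := by
  -- `c` is the curvature per observation, `B` caps the leverage, `C` is the factor of `p log t`,
  -- and `D` is the relative Lipschitz constant of the Hessian. None depends on `p`, `xx`, `r` or
  -- `t₀`, and `K` dominates every constant required.
  set c : ℝ := Real.exp (-(4 * Kmax)) / 4 * Kmin with hc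
  have hc0 : 0 < c := by positivity
  set B : ℝ := Kmax ^ 2 / c with hB
  have hB0 : 0 ≤ B := by positivity
  set C : ℝ := Real.exp (B + Kmax) * (1 + 2 * B) with hCdef
  have hC0 : 0 ≤ C := by positivity
  set D : ℝ := 2 * Kmax * Real.exp (4 * Kmax) with hDdef
  have hD0 : 0 ≤ D := by positivity
  set K : ℝ := 1 + c⁻¹ + Kmax ^ 2 + Kmax ^ 3 + 2 * Kmax + D + C with hK
  have hci : 0 < c⁻¹ := by positivity
  have hk2 : 0 < Kmax ^ 2 := by positivity
  have hk3 : 0 < Kmax ^ 3 := by positivity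
  refine ⟨K, by linarith, ?_⟩
  intro p hp xx r hxx hr S _ P _ x θstar Y θ₀ Om₀ t₀ hM hOm hEx ht₀ ht₀K
  have hKpos : 0 < K := by linarith
  have hx : ∀ s, 1 ≤ s → ‖x s‖ ≤ Kmax := fun s hs =>
    (le_mul_of_one_le_left (norm_nonneg _) (le_max_left _ _)).trans (hEx.norm_le s hs)
  have hKp : Kmax * p ≤ t₀ := by nlinarith [mul_pos hKmax hxx]
  have ht₀1 : (1 : ℝ) ≤ t₀ := by exact_mod_cast ht₀
  -- The factor `t₀ ≥ 1` is discarded; a fixed lower bound on `Ω_{t₀}` already gives bounded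
  -- leverages.
  have hlam : Kmin ≤ lamMin (∑ s ∈ goodIdx x θstar Kmax t₀, outer (x s)) :=
    (le_mul_of_one_le_right hKmin.le ht₀1).trans (hEx.lamMin_ge t₀ ht₀ hKp)
  have hlev : ∀ y, iter x y θ₀ Om₀ t₀ t₀ ∈ localSet θstar r → ∀ s, t₀ ≤ s →
      0 ≤ quadForm (prec x y θ₀ Om₀ t₀ (s + 1))⁻¹ (x (s + 1)) ∧
        quadForm (prec x y θ₀ Om₀ t₀ (s + 1))⁻¹ (x (s + 1)) ≤ B := fun y hθ s hs =>
    leverage_bounds hOm ht₀ hKmin hEx.norm_le hlam hθ hs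
  have hA := hM.measureReal_mapEst_notMem_le (hEx.map_mem t₀ ht₀ ht₀K)
  have hLR := hM.ville (isTestProcess_likelihood_ratio (θ₀ := θ₀) (Om₀ := Om₀) (t₀ := t₀))
    (Real.exp_pos xx) (by simp)
  have hdec := hM.ville (isTestProcess_decrement (θ₀ := θ₀) (Om₀ := Om₀) (t₀ := t₀)
    hEx.norm_le hlev) (Real.exp_pos xx) (by simp)
  rw [← Real.exp_neg] at hLR hdec
  obtain ⟨E, hEm, hEP, hE⟩ := exists_measurable_event_avoiding hA hLR hdec
  refine ⟨E, hEm, hEP, fun ω hω => ⟨fun t ht => ⟨fun θbar hθbar => ?_, ?_, ?_⟩, fun t ht =>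
    ⟨fun θ _ => ?_, fun θ _ θ' _ => ?_, fun θ _ h _ => ?_, fun θ₁ h₁ θ₂ h₂ => ?_⟩⟩⟩
  · have ht1 : 1 ≤ t := by omega
    have htt : (t₀ : ℝ) ≤ t := by exact_mod_cast ht.le
    refine le_lamMin_of_quadForm hp fun v => ?_
    refine le_trans ?_ (mul_norm_sq_le_quadForm_sum_hess hEx.norm_le
      (hEx.lamMin_ge t ht1 (hKp.trans htt)) hθbar v)
    have : K⁻¹ ≤ c := inv_le_of_inv_le₀ hc0 (by linarith)
    calc K⁻¹ * t * ‖v‖ ^ 2 ≤ c * t * ‖v‖ ^ 2 := by gcongr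
      _ = _ := by rw [hc]; ring
  · refine (sum_loss_sub_le_of_likelihood_ratio (hE ω hω).2.1 t).trans ?_
    exact le_mul_of_one_le_left hxx.le (by linarith)
  · have hθ : iter x (path Y ω) θ₀ Om₀ t₀ t₀ ∈ localSet θstar r := by
      rw [iter_switch ht₀]
      exact not_not.1 (hE ω hω).1
    have h1 := sum_decrement_le hOm ht₀ hc0 (Real.exp_pos _).le hx
      (prec_lower_bound hOm ht₀ hEx.norm_le hlam hθ le_rfl) hθ (hE ω hω).2.2 ht
    refine h1.trans ?_
    have hlog : (0 : ℝ) ≤ p * Real.log (stopAt x (path Y ω) θ₀ Om₀ t₀ θstar r t) :=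
      mul_nonneg (Nat.cast_nonneg _) (Real.log_natCast_nonneg _)
    rw [mul_add K]
    refine add_le_add (mul_le_mul_of_nonneg_right (?_ : C ≤ K) hlog)
      (le_mul_of_one_le_left hxx.le ?_) <;> linarith
  · refine (opNorm_hess_loss_le _ _ _).trans ?_
    have : ‖x t‖ ^ 2 ≤ Kmax ^ 2 := by gcongr; exact hx t ht
    linarith
  · refine (opNorm_hess_loss_sub_le _ _ _ _).trans ?_
    have : ‖x t‖ ^ 3 ≤ Kmax ^ 3 := by gcongr; exact hx t ht
    gcongr
    linarith
  · exact fisher_self_concordant hx (by linarith) θ h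
  · obtain ⟨θt, hseg, heq⟩ := loss_taylor (x t) (Y t ω) θ₁ θ₂
    refine ⟨θt, (convex_localSet θstar r).segment_subset h₁ h₂ hseg, hseg, ?_, heq⟩
    have hpsd := hess_loss_posSemidef (x t) (Y t ω) θt
    have h1 := hess_loss_le_of_mem_segment (y := Y t ω) (hEx.norm_le t ht) h₁ h₂ hseg
    have hKn : 0 ≤ 1 + K * ‖θ₁ - θ₂‖ := by positivity
    refine loewnerLE_of_quadForm_le (hess_loss_posSemidef _ _ _).isHermitian
      (hpsd.smul hKn).isHermitian fun v => ?_
    have h2 := quadForm_nonneg h1 v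
    have h3 := quadForm_nonneg hpsd v
    rw [quadForm_sub, quadForm_smul] at h2
    rw [quadForm_smul]
    refine (sub_nonneg.1 h2).trans (mul_le_mul_of_nonneg_right ?_ h3)
    have : D ≤ K := by linarith
    gcongr
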